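/- Let $K$ be a non-archimedean local field with absolute value $|\cdot|$ and Haar measure $\mu$ with $\mu(O_K)=1$. Let $\Gamma\subset \mathrm{PGL}_2(K)$ be a Schottky group, i.e. a discrete subgroup freely generated by $g\ge 1$ hyperbolic transformations, let $\Omega\subset\mathbb P^1(K)$ be the complement of the closure of its set of limit points, and let $F\subset K$, $F\subset\Omega$, be a compact open fundamental domain (every point of $\Omega$ lies in exactly one translate $\gamma F$, $\gamma\in\Gamma$). Let $\mathcal U$ be a verticial covering of $F$: a finite partition of $F$ into nonempty sets, each of which is an intersection of spheres $\{|x-c|=r\}$ of a common radius $r>0$ (depending on the set). Let $A=(A_{UV})_{U,V\in\mathcal U}$ be a symmetric real matrix with $A_{UV}\ge 0$, $A_{UU}=0$, and let $\alpha\in\mathbb R$, $s>0$, $\varepsilon>0$. With $m_{\gamma,U}=\max\{1,\sup_U|\gamma'|\}\in[1,\infty]$ put $$\int_{\Omega,s} f(y)\,dy=\sum_{\gamma\in\Gamma}\sum_{U\in\mathcal U} m_{\gamma,U}^{-s}\int_{\gamma U} f(y)\,dy ,$$ where a term with $\infty\in\gamma U$ (so that $m_{\gamma,U}=\infty$) is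 $0$. Assume that either $\infty\in\Omega$, or $g=1$, $\infty$ is a fixed point of $\Gamma$, and $|a|^s<\mu(aO_K)$ for all $a\in K$ with $0<|a|<1$ (for the normalised absolute value, for which $\mu(aO_K)=|a|$, the last condition says $s>1$). Let $C(\Omega)^\Gamma$ be the Banach space of $\Gamma$-invariant continuous functions $\Omega\to\mathbb R$ with the supremum norm, and let $$A^\alpha_\Gamma(x,y)=\sum_{\gamma,\delta\in\Gamma}\ \sum_{U,V\in\mathcal U}A_{UV}\,|\gamma^{-1}x-\delta^{-1}y|^\alpha\,1_{\gamma U}(x)\,1_{\delta V}(y),\qquad D^\alpha_{A,\Gamma}f(x)=\int_{\Omega,s}A^\alpha_\Gamma(x,y)\,(f(y)-f(x))\,dy .$$ Theorem. The integral defining $D^\alpha_{A,\Gamma}f(x)$ converges absolutely for all $f\in C(\Omega)^\Gamma$ and $x\in\Omega$, and there are probability measures $p_t(x,\cdot)$ ($t\ge0$, $x\in\Omega$) on the Borel $\sigma$-algebra of $\Omega$ such that: 1. For every $h_0\in C(\Omega)^\Gamma$ the Cauchy problem $\partial_t h=\varepsilon D^\alpha_{A,\Gamma}h$ for $t\ge0$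 (right derivative at $t=0$), $h(0,\cdot)=h_0$, has exactly one solution $h\colon[0,\infty)\to C(\Omega)^\Gamma$ that is differentiable on $[0,\infty)$ and of class $C^1$ on $(0,\infty)$, and it is given by $h(t,x)=\int_\Omega h_0(y)\,p_t(x,dy)$. 2. $p_t(x,\cdot)$ is a transition function (jointly measurable in $(t,x)$, $p_0(x,\cdot)=\delta_x$, Chapman–Kolmogorov), and for every initial distribution on $\Omega$ there is a Markov process in $\Omega$ with this transition function and initial distribution all of whose paths are right-continuous and have left limits, i.e. no discontinuities other than jumps. -/

import Mathlib

open MeasureTheory ProbabilityTheory Filter Topology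
open scoped ENNReal NNReal BoundedContinuousFunction

universe u

namespace MumfordHeat

/-- The group `PGL₂(K)`. -/
abbrev PGL2 (K : Type u) [Field K] : Type u := Matrix.ProjGenLinGroup (Fin 2) K

section Moebius

variable {K : Type u} [NontriviallyNormedField K]

/-- The quotient topology on `PGL₂(K)`. -/
instance instTopologicalSpacePGL2 : TopologicalSpace (PGL2 K) :=
  inferInstanceAs
    (TopologicalSpace (Matrix.GeneralLinearGroup (Fin 2) K ⧸
      Subgroup.center (Matrix.GeneralLinearGroup (Fin 2) K)))

/-- The action of `PGL₂(K)` by Möbius transformations on `ℙ¹(K) = K ∪ {∞}`. For a locally compact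
field `K`, the topology of `OnePoint K` is that of `ℙ¹(K)`. -/
noncomputable instance instMulActionPGL2 : MulAction (PGL2 K) (OnePoint K) :=
  letI : DecidableEq K := Classical.decEq K
  Matrix.ProjGenLinGroup.mulActionOfGL (n := Fin 2) (R := K) (α := OnePoint K) (by
    intro u x
    cases x with
    | infty => simp [OnePoint.smul_infty_eq_ite]
    | coe x => simp [OnePoint.smul_some_eq_ite])

/-- Borel sets of `ℙ¹(K)`. -/
instance instMeasurableSpaceProjLine : MeasurableSpace (OnePoint K) := borel _

instance instBorelSpaceProjLine : BorelSpace (OnePoint K) := ⟨rfl⟩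

/-- A Möbius transformation is hyperbolic if `|tr A|² > |det A|` for a representing matrix `A`
(equivalently `|tr A|² > 1` after scaling `A` to determinant one). -/
def IsHyperbolic (γ : PGL2 K) : Prop :=
  ∃ A : Matrix.GeneralLinearGroup (Fin 2) K, Matrix.ProjGenLinGroup.mk A = γ ∧
    ‖A.val.det‖ < ‖A.val.trace‖ ^ 2

/-- A Schottky group of rank `g`: a discrete subgroup of `PGL₂(K)` which is freely generated by
`g ≥ 1` hyperbolic transformations. -/
structure IsSchottky (Γ : Subgroup (PGL2 K)) (g : ℕ) : Prop where
  one_le : 1 ≤ g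
  discrete : DiscreteTopology Γ
  free : ∃ b : FreeGroupBasis (Fin g) Γ, ∀ i, IsHyperbolic (b i : PGL2 K)

/-- The limit points of `Γ`: limits of `γₙ x₀` for pairwise distinct `γₙ ∈ Γ`. -/
def limitPoints (Γ : Subgroup (PGL2 K)) : Set (OnePoint K) :=
  {x | ∃ x₀ : OnePoint K, ∃ γ : ℕ → Γ, Function.Injective γ ∧
    Tendsto (fun n => γ n • x₀) atTop (𝓝 x)}

/-- The set `Ω` of regular points: the complement of the closure of the set of limit points. -/
def regularSet (Γ : Subgroup (PGL2 K)) : Set (OnePoint K) := (closure (limitPoints Γ))ᶜ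

/-- The translate `γ U` in `ℙ¹(K)` of a subset `U` of `K`. -/
def translate (γ : PGL2 K) (U : Set K) : Set (OnePoint K) :=
  (fun z : K => γ • (z : OnePoint K)) '' U

/-- `F ⊆ K` is a compact open fundamental domain for the action of `Γ` on its regular set:
every regular point lies in exactly one translate of `F`. -/
structure IsFundDomain (Γ : Subgroup (PGL2 K)) (F : Set K) : Prop where
  isCompact : IsCompact F
  isOpen : IsOpen F
  subset : ∀ z ∈ F, (z : OnePoint K) ∈ regularSet Γ
  existsUnique : ∀ x ∈ regularSet Γ, ∃! γ : Γ, x ∈ translate (γ : PGL2 K) F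

/-- A finite family `U` of nonempty sets is a verticial covering of `F`: the sets are disjoint,
they cover `F`, and each of them is an intersection of spheres of the same radius. -/
structure IsVerticialCovering {ι : Type*} (F : Set K) (U : ι → Set K) : Prop where
  iUnion_eq : ⋃ i, U i = F
  disjoint : Pairwise (Function.onFun Disjoint U)
  nonempty : ∀ i, (U i).Nonempty
  spheres : ∀ i, ∃ (C : Finset K) (r : ℝ), C.Nonempty ∧ 0 < r ∧
    U i = ⋂ c ∈ C, Metric.sphere c r

/-- The absolute value `|det A| / |c z + d|²` of the derivative of `z ↦ (a z + b) / (c z + d)`;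
it is `∞` at the pole. -/
noncomputable def glDerivAbs (A : Matrix.GeneralLinearGroup (Fin 2) K) (z : K) : ℝ≥0∞ :=
  ‖A.val.det‖ₑ / ‖A.val 1 0 * z + A.val 1 1‖ₑ ^ 2

theorem glDerivAbs_mul_scalar (A : Matrix.GeneralLinearGroup (Fin 2) K) (u : Kˣ) (z : K) :
    glDerivAbs (A * Matrix.GeneralLinearGroup.scalar (Fin 2) u) z = glDerivAbs A z := by
  have h1 : (A * Matrix.GeneralLinearGroup.scalar (Fin 2) u).val = (u : K) • A.val := by
    ext i j
    simp [Matrix.mul_apply, Matrix.scalar_apply, Matrix.diagonal_apply, mul_comm]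
  have hu : ‖(u : K)‖ₑ ^ 2 ≠ 0 := by simp
  have hu' : ‖(u : K)‖ₑ ^ 2 ≠ ∞ := by simp
  have h2 : (u : K) * A.val 1 0 * z + (u : K) * A.val 1 1 =
      (u : K) * (A.val 1 0 * z + A.val 1 1) := by ring
  unfold glDerivAbs
  rw [h1, Matrix.det_smul]
  simp only [Matrix.smul_apply, smul_eq_mul, Fintype.card_fin, h2, enorm_mul, enorm_pow, mul_pow]
  exact ENNReal.mul_div_mul_left _ _ hu hu'

/-- `|γ'(z)|` for `γ ∈ PGL₂(K)` and `z ∈ K`. -/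
noncomputable def derivAbs (γ : PGL2 K) (z : K) : ℝ≥0∞ :=
  glDerivAbs (Function.surjInv Matrix.ProjGenLinGroup.mk_surjective γ) z

theorem derivAbs_mk (A : Matrix.GeneralLinearGroup (Fin 2) K) (z : K) :
    derivAbs (Matrix.ProjGenLinGroup.mk A) z = glDerivAbs A z := by
  obtain ⟨u, hu⟩ := Matrix.ProjGenLinGroup.mk_eq_mk_iff.1
    (Function.surjInv_eq Matrix.ProjGenLinGroup.mk_surjective (Matrix.ProjGenLinGroup.mk A))
  unfold derivAbs
  conv_rhs => rw [← hu]
  rw [glDerivAbs_mul_scalar]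

/-- The number `m_{γ,U} = max {1, max_U |γ'|}`. -/
noncomputable def weight (γ : PGL2 K) (U : Set K) : ℝ≥0∞ := max 1 (⨆ z ∈ U, derivAbs γ z)

/-- The measure on `Ω` underlying the weighted integral: integration against it is
`f ↦ ∑_γ ∑_U m_{γ,U}^{-s} ∫_{γU} f(x) dx`, where `dx` is the measure `μ` on `K`.
If `∞ ∈ γU`, then `m_{γ,U} = ∞` and the term of `γU` vanishes. -/
noncomputable def weightedMeasure [MeasurableSpace K] {ι : Type*} (μ : Measure K)
    (Γ : Subgroup (PGL2 K)) (U : ι → Set K) (s : ℝ) : Measure (regularSet Γ) :=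
  (Measure.sum fun q : Γ × ι =>
    weight (q.1 : PGL2 K) (U q.2) ^ (-s) •
      (μ.map ((↑) : K → OnePoint K)).restrict (translate (q.1 : PGL2 K) (U q.2))).comap
    Subtype.val

/-- `|x - y|` for two points of `ℙ¹(K)` lying in `K` (the value at `∞` is never used). -/
noncomputable def absDiff (x y : OnePoint K) : ℝ :=
  x.elim 0 fun a => y.elim 0 fun b => ‖a - b‖

open Classical in
/-- The kernel `∑_{U,V} A_{UV} |x - y|^α 1(x ∈ U) 1(y ∈ V)`. -/
noncomputable def baseKernel {ι : Type*} [Fintype ι] (U : ι → Set K) (A : Matrix ι ι ℝ) (α : ℝ)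
    (x y : OnePoint K) : ℝ :=
  ∑ i, ∑ j, if x ∈ ((↑) : K → OnePoint K) '' U i ∧ y ∈ ((↑) : K → OnePoint K) '' U j then
    A i j * absDiff x y ^ α else 0

/-- The doubly `Γ`-invariant kernel `∑_{γ,δ ∈ Γ} A^α(γ⁻¹ x, δ⁻¹ y)`; for a fundamental domain
covered by the disjoint sets `U i`, at most one term is nonzero for given `x`, `y`. -/
noncomputable def invKernel {ι : Type*} [Fintype ι] (Γ : Subgroup (PGL2 K)) (U : ι → Set K)
    (A : Matrix ι ι ℝ) (α : ℝ) (x y : OnePoint K) : ℝ :=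
  ∑' γ : Γ, ∑' δ : Γ, baseKernel U A α (γ⁻¹ • x) (δ⁻¹ • y)

/-- The operator `f ↦ ∫_{Ω,s} A_Γ^α(x, y) (f(y) - f(x)) dy`. -/
noncomputable def heatOperator [MeasurableSpace K] {ι : Type*} [Fintype ι] (μ : Measure K)
    (Γ : Subgroup (PGL2 K)) (U : ι → Set K) (A : Matrix ι ι ℝ) (α s : ℝ)
    (f : regularSet Γ → ℝ) (x : regularSet Γ) : ℝ :=
  ∫ y, invKernel Γ U A α x y * (f y - f x) ∂(weightedMeasure μ Γ U s)

/-- The Banach space `C(Ω)^Γ` of `Γ`-invariant real-valued continuous functions on `Ω` with the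
supremum norm. If `Γ` has a compact fundamental domain, then `Γ`-invariant continuous functions
are automatically bounded, see `exists_bound_of_invariant`. -/
def invFunctions (Γ : Subgroup (PGL2 K)) : Submodule ℝ (regularSet Γ →ᵇ ℝ) where
  carrier := {f | ∀ γ ∈ Γ, ∀ x y : regularSet Γ, γ • (x : OnePoint K) = y → f y = f x}
  add_mem' := by
    intro f g hf hg γ hγ x y h
    simp [hf γ hγ x y h, hg γ hγ x y h]
  zero_mem' := by
    intro γ hγ x y h
    simp
  smul_mem' := by
    intro c f hf γ hγ x y h
    simp [hf γ hγ x y h]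

theorem exists_bound_of_invariant (Γ : Subgroup (PGL2 K)) (F : Set K) (hF : IsFundDomain Γ F)
    (f : C(regularSet Γ, ℝ))
    (hf : ∀ γ ∈ Γ, ∀ x y : regularSet Γ, γ • (x : OnePoint K) = y → f y = f x) :
    ∃ C : ℝ, ∀ x, |f x| ≤ C := by
  let e : F → regularSet Γ := fun z => ⟨(z : K), hF.subset z z.2⟩
  have he : Continuous e :=
    (OnePoint.continuous_coe.comp continuous_subtype_val).subtype_mk _
  have : CompactSpace F := isCompact_iff_compactSpace.1 hF.isCompact
  obtain ⟨C, hC⟩ := (isCompact_range (f.continuous.comp he)).isBounded.exists_norm_le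
  refine ⟨C, fun x => ?_⟩
  obtain ⟨γ, ⟨z, hz, hzx⟩, -⟩ := hF.existsUnique x x.2
  rw [hf γ γ.2 (e ⟨z, hz⟩) x hzx]
  exact hC _ ⟨⟨z, hz⟩, rfl⟩

/-- `h` solves the Cauchy problem in `C(Ω)^Γ` with initial datum `h₀`: it is of class `C¹` on
`(0, ∞)`, satisfies `∂h/∂t = ε D h` for all `t ≥ 0` (with the right derivative at `t = 0`), and
`h(0) = h₀`. Only the values of `h` on `[0, ∞)` matter. -/
structure IsCauchySolution [MeasurableSpace K] {ι : Type*} [Fintype ι] (μ : Measure K)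
    (Γ : Subgroup (PGL2 K)) (U : ι → Set K) (A : Matrix ι ι ℝ) (α s ε : ℝ)
    (h₀ : invFunctions Γ) (h : ℝ → invFunctions Γ) : Prop where
  differentiableOn : DifferentiableOn ℝ h (Set.Ici 0)
  contDiffOn : ContDiffOn ℝ 1 h (Set.Ioi 0)
  heat_eq : ∀ t : ℝ, 0 ≤ t → ∀ x : regularSet Γ,
    (derivWithin h (Set.Ici 0) t).1 x = ε * heatOperator μ Γ U A α s (h t).1 x
  initial : h 0 = h₀

end Moebius

section Markov

variable {E : Type*} [MeasurableSpace E]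

/-- A time-homogeneous transition function on `E`: probability kernels `p t`, jointly measurable
in time and space, with `p 0 x = δ_x` and the Chapman-Kolmogorov property. -/
structure IsTransitionFunction (p : ℝ≥0 → Kernel E E) : Prop where
  isMarkovKernel : ∀ t, IsMarkovKernel (p t)
  zero : p 0 = Kernel.id
  add : ∀ s t, p (s + t) = p t ∘ₖ p s
  measurable : ∀ B : Set E, MeasurableSet B → Measurable fun q : ℝ≥0 × E => p q.1 q.2 B

/-- `X` is a Markov process on the probability space `(W, P)` with transition function `p` and
initial distribution `ν`, with respect to its own filtration. -/
structure IsMarkovProcess {W : Type*} [MeasurableSpace W] (P : Measure W)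
    (p : ℝ≥0 → Kernel E E) (ν : Measure E) (X : ℝ≥0 → W → E) : Prop where
  isProbabilityMeasure : IsProbabilityMeasure P
  measurable : ∀ t, Measurable (X t)
  initial : P.map (X 0) = ν
  markov : ∀ (s t : ℝ≥0) (B : Set E), MeasurableSet B →
    P[(X (s + t) ⁻¹' B).indicator (fun _ => (1 : ℝ)) |
        ⨆ r ∈ Set.Iic s, MeasurableSpace.comap (X r) inferInstance]
      =ᵐ[P] fun w => (p t (X s w)).real B

/-- A right-continuous path all of whose discontinuities are jumps: it has a left limit at every
time. -/
def IsCadlag {S : Type*} [TopologicalSpace S] (ξ : ℝ≥0 → S) : Prop :=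
  ∀ t, ContinuousWithinAt ξ (Set.Ici t) t ∧ ∃ l, Tendsto ξ (𝓝[<] t) (𝓝 l)

end Markov

end MumfordHeat

/-! The point is that the generator is bounded, so the whole theory reduces to exponentials of
bounded operators and to jump processes with bounded rates.

Two facts give boundedness. First, the invariant kernel depends only on the representatives of `x`
and `y` in `F` (`invKernel_eq`). There it is continuous, because the vanishing of `A i i` removes
the diagonal, the only place where a negative power could blow up; compactness of `F` then bounds
it. Second, the weighted measure `N` is finite. If `∞` is a regular point, the translates other than
the one containing `∞` are disjoint in a set whose trace on `K` is compact, and the pole kills the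
one piece that contains `∞` (`weightedMeasure_univ_lt_top_of_infty_mem`). If the rank is one and `∞`
is fixed, the group consists of the powers of an affine contraction, and the total mass is dominated
by two geometric series (`weightedMeasure_univ_lt_top_of_rank_one`).

Hence `exp (t ε D)` solves the Cauchy problem, and uniqueness is that of a Lipschitz differential
equation (`exists_solution_of_bounded`). For probability, write `ε D = c (T - 1)`, where `c`
dominates all jump rates and `T` is a Markov operator: draw a candidate point and a uniform number,
and accept or reject the jump (`exists_update`). Expanding the exponential gives `∑ e^{-ct} (ct)^n /
n! T^n h₀`. This is the expectation of `h₀` along a chain with step `T` run by a Poisson clock of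
rate `c`.

That process is built explicitly from independent exponential holding times and independent marks.
Its paths are step functions. The number of jumps is Poisson and independent of the chain
(`setLIntegral_hasJumps_chain`), and the Markov property follows from memorylessness by induction on
the number of jumps (`markov_of_hasJumps`). Comparing the two series, in `mainTheorem3`, identifies
the solution with the transition function. -/

namespace MumfordHeat

/-! ### Exponential holding times and Poisson weights. -/

section HoldingTimes

/-- The exponential distribution of rate `c`, as a measure on `ℝ≥0`. -/
noncomputable def holdLaw (c : ℝ) : Measure ℝ≥0 := (expMeasure c).map Real.toNNReal

theorem isProbabilityMeasure_holdLaw {c : ℝ} (hc : 0 < c) : IsProbabilityMeasure (holdLaw c) := by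
  have := isProbabilityMeasure_expMeasure hc
  exact Measure.isProbabilityMeasure_map measurable_real_toNNReal.aemeasurable

theorem lintegral_holdLaw (c : ℝ) {g : ℝ≥0 → ℝ≥0∞} (hg : Measurable g) :
    ∫⁻ τ, g τ ∂holdLaw c =
      ∫⁻ x in Set.Ioi (0 : ℝ), ENNReal.ofReal (c * Real.exp (-(c * x))) * g x.toNNReal := by
  have hm : Measurable (gammaPDF 1 c) := (measurable_gammaPDFReal 1 c).ennreal_ofReal
  have hg' : Measurable fun x : ℝ => g x.toNNReal := hg.comp measurable_real_toNNReal
  rw [holdLaw, lintegral_map hg measurable_real_toNNReal, expMeasure, gammaMeasure,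
    lintegral_withDensity_eq_lintegral_mul _ hm hg',
    setLIntegral_congr Ioi_ae_eq_Ici, ← lintegral_indicator measurableSet_Ici]
  refine lintegral_congr fun x => ?_
  by_cases hx : 0 ≤ x
  · rw [Set.indicator_of_mem (Set.mem_Ici.2 hx), Pi.mul_apply, gammaPDF_of_nonneg hx]
    simp
  · rw [Set.indicator_of_notMem (by simpa using hx), Pi.mul_apply,
      gammaPDF_of_neg (not_le.1 hx), zero_mul]

/-- The exponential distribution is memoryless. -/
theorem lintegral_holdLaw_memoryless (c : ℝ) (s : ℝ≥0) {g : ℝ≥0 → ℝ≥0∞} (hg : Measurable g) :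
    ∫⁻ τ, (Set.Ioi s).indicator (fun τ => g (τ - s)) τ ∂holdLaw c =
      ENNReal.ofReal (Real.exp (-(c * s))) * ∫⁻ τ, g τ ∂holdLaw c := by
  have hg' : Measurable fun x : ℝ => ENNReal.ofReal (c * Real.exp (-(c * x))) * g x.toNNReal :=
    Measurable.mul (by fun_prop) (hg.comp measurable_real_toNNReal)
  rw [lintegral_holdLaw c hg, lintegral_holdLaw c, ← lintegral_const_mul _ hg',
    ← lintegral_indicator measurableSet_Ioi, ← lintegral_indicator measurableSet_Ioi,
    ← lintegral_add_right_eq_self _ (s : ℝ)]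
  · refine lintegral_congr fun x => ?_
    by_cases hx : 0 < x
    · have hxs : 0 < x + s := by positivity
      have h1 : s < (x + s).toNNReal := by
        rw [Real.toNNReal_add hx.le s.coe_nonneg, Real.toNNReal_coe]
        simpa using hx
      have h2 : (x + s).toNNReal - s = x.toNNReal := by
        rw [Real.toNNReal_add hx.le s.coe_nonneg, Real.toNNReal_coe, add_tsub_cancel_right]
      rw [Set.indicator_of_mem (Set.mem_Ioi.2 hxs), Set.indicator_of_mem (Set.mem_Ioi.2 hx),
        Set.indicator_of_mem (Set.mem_Ioi.2 h1), h2, ← mul_assoc,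
        ← ENNReal.ofReal_mul (Real.exp_pos _).le]
      congr 2
      rw [mul_left_comm, ← Real.exp_add]
      ring_nf
    · rw [Set.indicator_of_notMem (s := Set.Ioi (0 : ℝ)) (a := x) (by simpa using hx)]
      -- The shift by `s` leaves the strip `x ≤ 0 < x + s` on the left-hand side; there the
      -- indicator of `Ioi s` vanishes.
      by_cases hxs : 0 < x + s
      · have h1 : (x + s).toNNReal ∉ Set.Ioi s := by
          simp only [Set.mem_Ioi, not_lt, Real.toNNReal_le_iff_le_coe]
          linarith
        rw [Set.indicator_of_mem (Set.mem_Ioi.2 hxs), Set.indicator_of_notMem h1, mul_zero]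
      · rw [Set.indicator_of_notMem (by simpa using hxs)]
  · exact (hg.comp (measurable_id.sub_const s)).indicator measurableSet_Ioi

/-- The Poisson probabilities for a Poisson process of rate `c` at time `t`. -/
noncomputable def poissonWeight (c : ℝ) (n : ℕ) (t : ℝ) : ℝ :=
  Real.exp (-(c * t)) * ((c * t) ^ n / n.factorial)

theorem poissonWeight_nonneg {c : ℝ} (hc : 0 ≤ c) (n : ℕ) {t : ℝ} (ht : 0 ≤ t) :
    0 ≤ poissonWeight c n t := by
  unfold poissonWeight
  positivity

theorem hasSum_poissonWeight (c t : ℝ) : HasSum (fun n => poissonWeight c n t) 1 := by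
  have h := (NormedSpace.expSeries_div_hasSum_exp (c * t)).mul_left (Real.exp (-(c * t)))
  rwa [← Real.exp_eq_exp_ℝ, ← Real.exp_add, neg_add_cancel, Real.exp_zero] at h

theorem measurable_poissonWeight (c : ℝ) (n : ℕ) : Measurable (poissonWeight c n) := by
  unfold poissonWeight
  fun_prop

/-- This is conditioning on the first jump. The exponentials combine to the constant `e^{-ct}`, and
what remains is the integral of `(t - x)^n` over `[0, t]`, which raises the Poisson index by one. -/
theorem lintegral_holdLaw_poissonWeight {c : ℝ} (hc : 0 < c) (n : ℕ) (t : ℝ≥0) :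
    ∫⁻ τ, (Set.Iic t).indicator
        (fun τ => ENNReal.ofReal (poissonWeight c n (t - τ : ℝ≥0))) τ ∂holdLaw c =
      ENNReal.ofReal (poissonWeight c (n + 1) t) := by
  have hm : Measurable fun τ : ℝ≥0 => ENNReal.ofReal (poissonWeight c n (t - τ : ℝ≥0)) :=
    ((measurable_poissonWeight c n).comp
      (measurable_coe_nnreal_real.comp (measurable_id.const_sub t))).ennreal_ofReal
  rw [lintegral_holdLaw c (hm.indicator measurableSet_Iic)]
  have h1 : ∫⁻ x in Set.Ioi (0 : ℝ), ENNReal.ofReal (c * Real.exp (-(c * x))) *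
        (Set.Iic t).indicator (fun τ : ℝ≥0 => ENNReal.ofReal (poissonWeight c n (t - τ : ℝ≥0)))
          x.toNNReal =
      ∫⁻ x in Set.Ioc (0 : ℝ) t, ENNReal.ofReal
        (Real.exp (-(c * t)) * c ^ (n + 1) / n.factorial * (t - x) ^ n) := by
    rw [← lintegral_indicator measurableSet_Ioi, ← lintegral_indicator measurableSet_Ioc]
    refine lintegral_congr fun x => ?_
    by_cases hx : 0 < x
    · rw [Set.indicator_of_mem (Set.mem_Ioi.2 hx)]
      by_cases hxt : x ≤ t
      · have h2 : x.toNNReal ≤ t := Real.toNNReal_le_iff_le_coe.2 hxt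
        rw [Set.indicator_of_mem (Set.mem_Iic.2 h2), Set.indicator_of_mem (Set.mem_Ioc.2 ⟨hx, hxt⟩),
          ← ENNReal.ofReal_mul (by positivity), NNReal.coe_sub h2, Real.coe_toNNReal _ hx.le]
        congr 1
        unfold poissonWeight
        have h3 : Real.exp (-(c * t)) = Real.exp (-(c * x)) * Real.exp (-(c * (t - x))) := by
          rw [← Real.exp_add]
          ring_nf
        rw [h3, mul_pow, pow_succ]
        ring
      · have h2 : x.toNNReal ∉ Set.Iic t := fun h =>
          hxt (Real.toNNReal_le_iff_le_coe.1 (Set.mem_Iic.1 h))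
        rw [Set.indicator_of_notMem h2, mul_zero, Set.indicator_of_notMem fun h => hxt h.2]
    · rw [Set.indicator_of_notMem (by simpa using hx), Set.indicator_of_notMem fun h => hx h.1]
  have hcont : Continuous fun x : ℝ =>
    Real.exp (-(c * t)) * c ^ (n + 1) / n.factorial * (t - x) ^ n := by fun_prop
  rw [h1, ← ofReal_integral_eq_lintegral_ofReal, ← intervalIntegral.integral_of_le t.coe_nonneg,
    intervalIntegral.integral_const_mul,
    intervalIntegral.integral_comp_sub_left (fun y => y ^ n) (t : ℝ), integral_pow]
  · congr 1
    unfold poissonWeight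
    rw [Nat.factorial_succ]
    push_cast
    field_simp
    simp [mul_pow]
  · exact hcont.integrableOn_Ioc
  · filter_upwards [ae_restrict_mem measurableSet_Ioc] with x hx
    have := sub_nonneg.2 hx.2
    simp only [Pi.zero_apply]
    positivity

end HoldingTimes

/-! ### Splitting off the first term of an i.i.d. sequence. -/

section Sequences

variable {X : Type*}

/-- The sequence obtained by prepending a term. -/
def consSeq (e : X) (ω : ℕ → X) : ℕ → X
  | 0 => e
  | n + 1 => ω n

/-- The sequence without its first term. -/
def tailSeq (ω : ℕ → X) : ℕ → X := fun n => ω (n + 1)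

@[simp] theorem consSeq_zero (e : X) (ω : ℕ → X) : consSeq e ω 0 = e := rfl

@[simp] theorem tailSeq_consSeq (e : X) (ω : ℕ → X) : tailSeq (consSeq e ω) = ω := rfl

variable [MeasurableSpace X]

theorem measurable_consSeq : Measurable fun q : X × (ℕ → X) => consSeq q.1 q.2 := by
  refine measurable_pi_iff.2 fun n => ?_
  cases n with
  | zero => exact measurable_fst
  | succ n => exact (measurable_pi_apply n).comp measurable_snd

@[fun_prop]
theorem measurable_tailSeq : Measurable (tailSeq : (ℕ → X) → ℕ → X) :=
  measurable_pi_iff.2 fun n => measurable_pi_apply (n + 1)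

variable (m : Measure X) [IsProbabilityMeasure m]

/-- The infinite product measure is determined by its values on finite boxes, and on a box the
factor at index `0` splits off. All later first-step analysis rests on this. -/
theorem map_consSeq_infinitePi :
    (m.prod (Measure.infinitePi fun _ : ℕ => m)).map (fun q : X × (ℕ → X) => consSeq q.1 q.2) =
      Measure.infinitePi fun _ : ℕ => m := by
  refine Measure.eq_infinitePi (fun _ : ℕ => m) fun s t ht => ?_
  rw [Measure.map_apply measurable_consSeq (MeasurableSet.pi s.countable_toSet fun i _ => ht i)]
  have h1 : (fun q : X × (ℕ → X) => consSeq q.1 q.2) ⁻¹' (Set.pi s t) =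
      {e | 0 ∈ s → e ∈ t 0} ×ˢ
        Set.pi (s.preimage Nat.succ (Nat.succ_injective.injOn)) (fun n => t (n + 1)) := by
    ext ⟨e, ω⟩
    simp only [Set.mem_preimage, Set.mem_pi, Finset.mem_coe, Set.mem_prod, Set.mem_ofPred_eq,
      Finset.mem_preimage]
    constructor
    · exact fun h => ⟨fun h0 => h 0 h0, fun n hn => h (n + 1) hn⟩
    · rintro ⟨h0, h⟩ n hn
      cases n with
      | zero => exact h0 hn
      | succ n => exact h n hn
  rw [h1, Measure.prod_prod, Measure.infinitePi_pi _ fun i _ => ht (i + 1)]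
  have h2 : ∏ i ∈ s.preimage Nat.succ (Nat.succ_injective.injOn), m (t (i + 1)) =
      ∏ i ∈ s.erase 0, m (t i) := by
    rw [← Finset.prod_preimage Nat.succ (s.erase 0) Nat.succ_injective.injOn fun i => m (t i)]
    · refine Finset.prod_congr ?_ fun _ _ => rfl
      ext i
      simp
    · intro i hi hi'
      refine absurd ⟨i - 1, ?_⟩ hi'
      have := (Finset.mem_erase.1 hi).1
      simp only [Nat.succ_eq_add_one]
      omega
  rw [h2]
  by_cases h0 : 0 ∈ s
  · rw [← Finset.mul_prod_erase s _ h0]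
    simp [h0]
  · rw [Finset.erase_eq_of_notMem h0]
    simp [h0]

theorem lintegral_infinitePi_consSeq {f : (ℕ → X) → ℝ≥0∞} (hf : Measurable f) :
    ∫⁻ ω, f ω ∂(Measure.infinitePi fun _ : ℕ => m) =
      ∫⁻ e, ∫⁻ ω, f (consSeq e ω) ∂(Measure.infinitePi fun _ : ℕ => m) ∂m := by
  conv_lhs => rw [← map_consSeq_infinitePi m]
  rw [lintegral_map hf measurable_consSeq]
  exact lintegral_prod _ (hf.comp measurable_consSeq).aemeasurable

end Sequences

/-! ### Step paths built from holding times and marks. -/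

section JumpProcess

variable {S V : Type*}

/-- The `n`-th jump time of a sequence of holding times (with marks). -/
noncomputable def jumpTime (ω : ℕ → ℝ≥0 × V) (n : ℕ) : ℝ≥0 := ∑ i ∈ Finset.range n, (ω i).1

/-- Exactly `n` jumps occur up to time `t`. -/
def HasJumps (ω : ℕ → ℝ≥0 × V) (t : ℝ≥0) (n : ℕ) : Prop :=
  jumpTime ω n ≤ t ∧ t < jumpTime ω (n + 1)

/-- Only finitely many jumps occur up to any time. -/
def NonExplosive (ω : ℕ → ℝ≥0 × V) : Prop := ∀ t : ℝ≥0, ∃ n, t < jumpTime ω (n + 1)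

/-- The chain obtained from the update function `φ` and the marks `(ω n).2`. -/
def chain (φ : S × V → S) : ℕ → S → (ℕ → ℝ≥0 × V) → S
  | 0, x, _ => x
  | n + 1, x, ω => chain φ n (φ (x, (ω 0).2)) (tailSeq ω)

open Classical in
/-- The jump process with holding times `(ω n).1` and update function `φ`, started at `x`; it is
constant if there are infinitely many jumps in finite time. -/
noncomputable def path (φ : S × V → S) (x : S) (ω : ℕ → ℝ≥0 × V) (t : ℝ≥0) : S :=
  if h : NonExplosive ω then chain φ (Nat.find (h t)) x ω else x

theorem jumpTime_zero (ω : ℕ → ℝ≥0 × V) : jumpTime ω 0 = 0 := by simp [jumpTime]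

theorem jumpTime_succ (ω : ℕ → ℝ≥0 × V) (n : ℕ) :
    jumpTime ω (n + 1) = (ω 0).1 + jumpTime (tailSeq ω) n := by
  rw [jumpTime, Finset.sum_range_succ', add_comm]
  rfl

theorem jumpTime_mono (ω : ℕ → ℝ≥0 × V) : Monotone (jumpTime ω) :=
  monotone_nat_of_le_succ fun n => by
    rw [jumpTime, jumpTime, Finset.sum_range_succ]
    exact le_self_add

theorem hasJumps_zero {ω : ℕ → ℝ≥0 × V} {t : ℝ≥0} : HasJumps ω t 0 ↔ t < (ω 0).1 := by
  simp [HasJumps, jumpTime_succ, jumpTime_zero]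

/-- The renewal step: after the first jump the clock restarts with the tail sequence. It drives the
inductions on the number of jumps. -/
theorem hasJumps_succ {ω : ℕ → ℝ≥0 × V} {t : ℝ≥0} {n : ℕ} :
    HasJumps ω t (n + 1) ↔ (ω 0).1 ≤ t ∧ HasJumps (tailSeq ω) (t - (ω 0).1) n := by
  rw [HasJumps, HasJumps, jumpTime_succ, jumpTime_succ]
  constructor
  · rintro ⟨h1, h2⟩
    have h : (ω 0).1 ≤ t := le_self_add.trans h1
    exact ⟨h, le_tsub_of_add_le_left h1, (tsub_lt_iff_left h).2 h2⟩
  · rintro ⟨h, h1, h2⟩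
    exact ⟨(le_tsub_iff_left h).1 h1, (tsub_lt_iff_left h).1 h2⟩

theorem HasJumps.unique {ω : ℕ → ℝ≥0 × V} {t : ℝ≥0} {m n : ℕ} (hm : HasJumps ω t m)
    (hn : HasJumps ω t n) : m = n := by
  by_contra h
  rcases lt_or_gt_of_ne h with h | h
  · exact absurd (hm.2.trans_le (jumpTime_mono ω h)) (not_lt.2 hn.1)
  · exact absurd (hn.2.trans_le (jumpTime_mono ω h)) (not_lt.2 hm.1)

theorem NonExplosive.exists_hasJumps {ω : ℕ → ℝ≥0 × V} (h : NonExplosive ω) (t : ℝ≥0) :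
    ∃ n, HasJumps ω t n := by
  classical
  refine ⟨Nat.find (h t), ?_, Nat.find_spec (h t)⟩
  by_contra hlt
  cases hn : Nat.find (h t) with
  | zero => exact hlt (by rw [hn, jumpTime_zero]; exact zero_le)
  | succ k =>
    rw [hn, not_le] at hlt
    exact Nat.find_min (h t) (by omega) hlt

theorem nonExplosive_tailSeq {ω : ℕ → ℝ≥0 × V} : NonExplosive (tailSeq ω) ↔ NonExplosive ω := by
  constructor
  · intro h t
    obtain ⟨n, hn⟩ := h t
    exact ⟨n + 1, by rw [jumpTime_succ]; exact hn.trans_le le_add_self⟩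
  · intro h t
    obtain ⟨n, hn⟩ := h ((ω 0).1 + t)
    rw [jumpTime_succ] at hn
    exact ⟨n, (lt_of_add_lt_add_left hn).trans_le (jumpTime_mono _ n.le_succ)⟩

/-- Integer times suffice by monotonicity. The resulting countable condition gives measurability of
non-explosion and its almost sure validity. -/
theorem nonExplosive_iff_nat {ω : ℕ → ℝ≥0 × V} :
    NonExplosive ω ↔ ∀ k : ℕ, ∃ n, HasJumps ω k n := by
  refine ⟨fun h k => h.exists_hasJumps k, fun h t => ?_⟩
  obtain ⟨k, hk⟩ := exists_nat_gt t
  obtain ⟨n, hn⟩ := h k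
  exact ⟨n, hk.trans hn.2⟩

variable {φ : S × V → S}

theorem path_of_hasJumps {ω : ℕ → ℝ≥0 × V} (h : NonExplosive ω) {t : ℝ≥0} {n : ℕ}
    (hn : HasJumps ω t n) (x : S) : path φ x ω t = chain φ n x ω := by
  classical
  have : Nat.find (h t) = n := by
    refine (Nat.find_eq_iff (h t)).2 ⟨hn.2, fun k hk => not_lt.2 ?_⟩
    exact (jumpTime_mono ω hk).trans hn.1
  rw [path, dif_pos h, this]

theorem path_of_explosive {ω : ℕ → ℝ≥0 × V} (h : ¬ NonExplosive ω) (t : ℝ≥0) (x : S) :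
    path φ x ω t = x := by rw [path, dif_neg h]

theorem path_of_lt {ω : ℕ → ℝ≥0 × V} {t : ℝ≥0} (ht : t < (ω 0).1) (x : S) :
    path φ x ω t = x := by
  by_cases h : NonExplosive ω
  · rw [path_of_hasJumps h (hasJumps_zero.2 ht)]
    rfl
  · exact path_of_explosive h t x

theorem path_of_le {ω : ℕ → ℝ≥0 × V} (h : NonExplosive ω) {t : ℝ≥0} (ht : (ω 0).1 ≤ t) (x : S) :
    path φ x ω t = path φ (φ (x, (ω 0).2)) (tailSeq ω) (t - (ω 0).1) := by
  have h' := nonExplosive_tailSeq.2 h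
  obtain ⟨n, hn⟩ := h'.exists_hasJumps (t - (ω 0).1)
  rw [path_of_hasJumps h' hn, path_of_hasJumps h (hasJumps_succ.2 ⟨ht, hn⟩)]
  rfl

/-- Without explosion the path is constant on each interval between consecutive jump times; with
explosion it is constant by definition. So the claim holds for every `ω`, not just almost surely,
and in any topology on `S`. -/
theorem isCadlag_path [TopologicalSpace S] (x : S) (ω : ℕ → ℝ≥0 × V) :
    IsCadlag (path φ x ω) := by
  by_cases h : NonExplosive ω
  swap
  · have : path φ x ω = fun _ => x := funext fun t => path_of_explosive h t x
    rw [this]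
    exact fun t => ⟨continuousWithinAt_const, x, tendsto_const_nhds⟩
  intro t
  constructor
  · obtain ⟨n, hn⟩ := h.exists_hasJumps t
    refine (continuousWithinAt_const (b := path φ x ω t)).congr_of_eventuallyEq ?_ rfl
    filter_upwards [self_mem_nhdsWithin, mem_nhdsWithin_of_mem_nhds (Iio_mem_nhds hn.2)]
      with r hr hr'
    rw [path_of_hasJumps h hn, path_of_hasJumps h (n := n) ⟨hn.1.trans hr, hr'⟩]
  · by_cases ht : t = 0
    · refine ⟨x, ?_⟩
      have : Set.Iio (0 : ℝ≥0) = ∅ := by ext; simp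
      rw [ht, this, nhdsWithin_empty]
      exact tendsto_bot
    · classical
      -- The inequality is weak, in contrast to `HasJumps`: if `t` is itself a jump time, the left
      -- limit is the state before that jump.
      have hex : ∃ n, t ≤ jumpTime ω (n + 1) := (h t).imp fun n hn => hn.le
      have h1 : jumpTime ω (Nat.find hex) < t := by
        cases hn : Nat.find hex with
        | zero => rw [jumpTime_zero]; exact pos_iff_ne_zero.2 ht
        | succ k => exact not_le.1 (Nat.find_min hex (m := k) (by omega))
      refine ⟨chain φ (Nat.find hex) x ω, (tendsto_const_nhds).congr' ?_⟩
      filter_upwards [self_mem_nhdsWithin, mem_nhdsWithin_of_mem_nhds (Ioi_mem_nhds h1)]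
        with r hr hr'
      exact (path_of_hasJumps h ⟨le_of_lt hr', lt_of_lt_of_le hr (Nat.find_spec hex)⟩ x).symm

section Measurability

variable [MeasurableSpace S] [MeasurableSpace V]

@[fun_prop]
theorem measurable_jumpTime (n : ℕ) :
    Measurable fun ω : ℕ → ℝ≥0 × V => jumpTime ω n :=
  Finset.measurable_sum _ fun i _ => measurable_fst.comp (measurable_pi_apply i)

theorem measurableSet_hasJumps (n : ℕ) :
    MeasurableSet {q : ℝ≥0 × (ℕ → ℝ≥0 × V) | HasJumps q.2 q.1 n} :=
  (measurableSet_le ((measurable_jumpTime n).comp measurable_snd) measurable_fst).inter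
    (measurableSet_lt (f := fun q : ℝ≥0 × (ℕ → ℝ≥0 × V) => q.1)
      (g := fun q => jumpTime q.2 (n + 1)) measurable_fst
      ((measurable_jumpTime (n + 1)).comp measurable_snd))

theorem measurableSet_hasJumps_left (t : ℝ≥0) (n : ℕ) :
    MeasurableSet {ω : ℕ → ℝ≥0 × V | HasJumps ω t n} :=
  measurable_prodMk_left (x := t) (measurableSet_hasJumps n)

theorem measurableSet_nonExplosive : MeasurableSet {ω : ℕ → ℝ≥0 × V | NonExplosive ω} := by
  have : {ω : ℕ → ℝ≥0 × V | NonExplosive ω} = ⋂ k : ℕ, ⋃ n, {ω | HasJumps ω k n} := by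
    ext ω
    simp [nonExplosive_iff_nat]
  rw [this]
  exact MeasurableSet.iInter fun k => MeasurableSet.iUnion fun n => measurableSet_hasJumps_left k n

theorem measurable_chain (hφ : Measurable φ) (n : ℕ) :
    Measurable fun q : S × (ℕ → ℝ≥0 × V) => chain φ n q.1 q.2 := by
  induction n with
  | zero => exact measurable_fst
  | succ n ih =>
    refine ih.comp (Measurable.prodMk (hφ.comp (measurable_fst.prodMk ?_)) ?_)
    · exact measurable_snd.comp ((measurable_pi_apply 0).comp measurable_snd)
    · exact measurable_tailSeq.comp measurable_snd

theorem measurable_path (hφ : Measurable φ) :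
    Measurable fun q : ℝ≥0 × S × (ℕ → ℝ≥0 × V) => path φ q.2.1 q.2.2 q.1 := by
  intro B hB
  have : (fun q : ℝ≥0 × S × (ℕ → ℝ≥0 × V) => path φ q.2.1 q.2.2 q.1) ⁻¹' B =
      ({q | ¬ NonExplosive q.2.2} ∩ {q | q.2.1 ∈ B}) ∪
        ⋃ n, ({q | NonExplosive q.2.2} ∩ {q | HasJumps q.2.2 q.1 n}) ∩
          {q | chain φ n q.2.1 q.2.2 ∈ B} := by
    ext ⟨t, x, ω⟩
    by_cases h : NonExplosive ω
    · obtain ⟨n, hn⟩ := h.exists_hasJumps t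
      simp only [Set.mem_preimage, path_of_hasJumps h hn, Set.mem_union, Set.mem_inter_iff,
        Set.mem_ofPred_eq, h, not_true_eq_false, false_and, false_or, Set.mem_iUnion, true_and]
      exact ⟨fun hB => ⟨n, hn, hB⟩, fun ⟨k, hk, hB⟩ => hn.unique hk ▸ hB⟩
    · simp [path_of_explosive h, h]
  rw [this]
  have h1 : MeasurableSet {q : ℝ≥0 × S × (ℕ → ℝ≥0 × V) | NonExplosive q.2.2} :=
    measurable_snd.comp measurable_snd measurableSet_nonExplosive
  refine (h1.compl.inter ((measurable_fst.comp measurable_snd) hB)).union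
    (MeasurableSet.iUnion fun n => (h1.inter ?_).inter ?_)
  · exact (measurable_fst.prodMk (measurable_snd.comp measurable_snd)) (measurableSet_hasJumps n)
  · exact ((measurable_chain hφ n).comp measurable_snd) hB

theorem measurable_path_right (hφ : Measurable φ) (t : ℝ≥0) (x : S) :
    Measurable fun ω : ℕ → ℝ≥0 × V => path φ x ω t :=
  (measurable_path hφ).comp (measurable_const.prodMk (measurable_const.prodMk measurable_id))

end Measurability

end JumpProcess

/-! ### Law of the jump process: Poisson clock and Markov property. -/

section JumpLaw

theorem indicator_eq_indicator_of_iff {α β M : Type*} [Zero M] {a : α} {b : β} {s : Set α}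
    {t : Set β} {f : α → M} {g : β → M} (h : a ∈ s ↔ b ∈ t) (hfg : f a = g b) :
    s.indicator f a = t.indicator g b := by
  by_cases ha : a ∈ s
  · rw [Set.indicator_of_mem ha, Set.indicator_of_mem (h.1 ha), hfg]
  · rw [Set.indicator_of_notMem ha, Set.indicator_of_notMem (mt h.2 ha)]

variable {S V : Type*} [MeasurableSpace S] [MeasurableSpace V]

instance instIsProbabilityMeasureHoldLaw (c : ℝ) [hc : Fact (0 < c)] :
    IsProbabilityMeasure (holdLaw c) := isProbabilityMeasure_holdLaw hc.out

/-- The law of independent exponential holding times and independent marks of law `ρ`. -/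
noncomputable def noiseLaw (c : ℝ) [Fact (0 < c)] (ρ : Measure V) [IsProbabilityMeasure ρ] :
    Measure (ℕ → ℝ≥0 × V) :=
  Measure.infinitePi fun _ => (holdLaw c).prod ρ

variable (c : ℝ) [Fact (0 < c)] (ρ : Measure V) [IsProbabilityMeasure ρ]

instance instIsProbabilityMeasureNoiseLaw : IsProbabilityMeasure (noiseLaw c ρ) := by
  unfold noiseLaw
  infer_instance

theorem lintegral_noiseLaw {f : (ℕ → ℝ≥0 × V) → ℝ≥0∞} (hf : Measurable f) :
    ∫⁻ ω, f ω ∂noiseLaw c ρ =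
      ∫⁻ v, ∫⁻ τ, ∫⁻ ω, f (consSeq (τ, v) ω) ∂noiseLaw c ρ ∂holdLaw c ∂ρ := by
  rw [noiseLaw, lintegral_infinitePi_consSeq _ hf]
  exact lintegral_prod_symm' _ (hf.comp measurable_consSeq).lintegral_prod_right'

variable {φ : S × V → S} (hφ : Measurable φ)

include hφ in
-- The chain uses only the marks and the event only the holding times, so they are independent.
-- Integrating out the first holding time and mark turns index `n` into `n + 1` on both sides.
theorem setLIntegral_hasJumps_chain (n : ℕ) (t : ℝ≥0) (x : S) {f : S → ℝ≥0∞} (hf : Measurable f) :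
    ∫⁻ ω in {ω | HasJumps ω t n}, f (chain φ n x ω) ∂noiseLaw c ρ =
      ENNReal.ofReal (poissonWeight c n t) * ∫⁻ ω, f (chain φ n x ω) ∂noiseLaw c ρ := by
  have hm : ∀ (n : ℕ) (x : S), Measurable fun ω : ℕ → ℝ≥0 × V => f (chain φ n x ω) := fun n x =>
    hf.comp ((measurable_chain hφ n).comp measurable_prodMk_left)
  induction n generalizing t x with
  | zero =>
    rw [← lintegral_indicator (measurableSet_hasJumps_left t 0),
      lintegral_noiseLaw c ρ ((hm 0 x).indicator (measurableSet_hasJumps_left t 0))]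
    have h1 : ∀ (v : V) (τ : ℝ≥0) (ω : ℕ → ℝ≥0 × V),
        {ω | HasJumps ω t 0}.indicator (fun ω => f (chain φ 0 x ω)) (consSeq (τ, v) ω) =
          (Set.Ioi t).indicator (fun _ => f x) τ := by
      intro v τ ω
      simp only [Set.indicator, Set.mem_ofPred_eq, hasJumps_zero, consSeq_zero, Set.mem_Ioi]
      rfl
    simp only [h1, lintegral_const, measure_univ, mul_one]
    have h2 := lintegral_holdLaw_memoryless c t (measurable_const (a := f x))
    rw [h2]
    simp [chain, poissonWeight]
  | succ n ih =>
    rw [← lintegral_indicator (measurableSet_hasJumps_left t (n + 1)),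
      lintegral_noiseLaw c ρ ((hm (n + 1) x).indicator (measurableSet_hasJumps_left t (n + 1))),
      lintegral_noiseLaw c ρ (hm (n + 1) x)]
    have h1 : ∀ (v : V) (τ : ℝ≥0), ∫⁻ ω, {ω | HasJumps ω t (n + 1)}.indicator
          (fun ω => f (chain φ (n + 1) x ω)) (consSeq (τ, v) ω) ∂noiseLaw c ρ =
        (Set.Iic t).indicator (fun τ => ENNReal.ofReal (poissonWeight c n (t - τ : ℝ≥0))) τ *
          ∫⁻ ω, f (chain φ n (φ (x, v)) ω) ∂noiseLaw c ρ := by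
      intro v τ
      by_cases hτ : τ ≤ t
      · rw [Set.indicator_of_mem (Set.mem_Iic.2 hτ), ← ih,
          ← lintegral_indicator (measurableSet_hasJumps_left _ n)]
        refine lintegral_congr fun ω => ?_
        refine indicator_eq_indicator_of_iff ?_ rfl
        simp only [Set.mem_ofPred_eq, hasJumps_succ, consSeq_zero, tailSeq_consSeq, hτ, true_and]
      · rw [Set.indicator_of_notMem (by simpa using hτ), zero_mul]
        simp [Set.indicator, hasJumps_succ, hτ]
    have h2 : ∀ (v : V) (τ : ℝ≥0), ∫⁻ ω, f (chain φ (n + 1) x (consSeq (τ, v) ω)) ∂noiseLaw c ρ =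
        ∫⁻ ω, f (chain φ n (φ (x, v)) ω) ∂noiseLaw c ρ := fun v τ => rfl
    have hp : Measurable fun τ : ℝ≥0 => (Set.Iic t).indicator
        (fun τ => ENNReal.ofReal (poissonWeight c n (t - τ : ℝ≥0))) τ :=
      ((measurable_poissonWeight c n).comp (measurable_coe_nnreal_real.comp
        (measurable_id.const_sub t))).ennreal_ofReal.indicator measurableSet_Iic
    have hq : Measurable fun v => ∫⁻ ω, f (chain φ n (φ (x, v)) ω) ∂noiseLaw c ρ := by
      refine Measurable.lintegral_prod_right' (f := fun q : V × (ℕ → ℝ≥0 × V) =>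
        f (chain φ n (φ (x, q.1)) q.2)) ?_
      exact hf.comp ((measurable_chain hφ n).comp
        ((hφ.comp (measurable_const.prodMk measurable_fst)).prodMk measurable_snd))
    simp only [h1, h2]
    simp only [lintegral_mul_const _ hp, lintegral_holdLaw_poissonWeight (Fact.out : 0 < c),
      lintegral_const, measure_univ, mul_one]
    rw [lintegral_const_mul _ hq]

theorem noiseLaw_hasJumps (n : ℕ) (t : ℝ≥0) :
    noiseLaw c ρ {ω | HasJumps ω t n} = ENNReal.ofReal (poissonWeight c n t) := by
  -- With a one-point state space the chain carries no information and only the clock remains.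
  have h := setLIntegral_hasJumps_chain c ρ (φ := fun q : Unit × V => q.1) measurable_fst n t ()
    (measurable_const (a := (1 : ℝ≥0∞)))
  simpa using h

omit [MeasurableSpace V] in
theorem pairwise_disjoint_hasJumps (t : ℝ≥0) :
    Pairwise (Function.onFun Disjoint fun n => {ω : ℕ → ℝ≥0 × V | HasJumps ω t n}) :=
  fun _ _ hmn => Set.disjoint_left.2 fun _ hm hn => hmn (hm.unique hn)

/-- The Poisson weights sum to one, so no mass is left for infinitely many jumps before `t`. -/
theorem ae_exists_hasJumps (t : ℝ≥0) : ∀ᵐ ω ∂noiseLaw c ρ, ∃ n, HasJumps ω t n := by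
  have hU : MeasurableSet (⋃ n, {ω : ℕ → ℝ≥0 × V | HasJumps ω t n}) :=
    MeasurableSet.iUnion (measurableSet_hasJumps_left t)
  have h : noiseLaw c ρ (⋃ n, {ω | HasJumps ω t n}) = 1 := by
    rw [measure_iUnion (pairwise_disjoint_hasJumps t) (measurableSet_hasJumps_left t)]
    simp only [noiseLaw_hasJumps]
    rw [← ENNReal.ofReal_tsum_of_nonneg
      (fun n => poissonWeight_nonneg (Fact.out : 0 < c).le n t.coe_nonneg)
      (hasSum_poissonWeight c t).summable, (hasSum_poissonWeight c t).tsum_eq, ENNReal.ofReal_one]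
  filter_upwards [(mem_ae_iff_prob_eq_one hU).2 h] with ω hω
  simpa using hω

theorem ae_nonExplosive : ∀ᵐ ω ∂noiseLaw c ρ, NonExplosive ω := by
  simp only [nonExplosive_iff_nat]
  exact ae_all_iff.2 fun k => ae_exists_hasJumps c ρ k

theorem setLIntegral_eq_tsum_hasJumps (t : ℝ≥0) (D : Set (ℕ → ℝ≥0 × V))
    (f : (ℕ → ℝ≥0 × V) → ℝ≥0∞) :
    ∫⁻ ω in D, f ω ∂noiseLaw c ρ =
      ∑' n, ∫⁻ ω in {ω | HasJumps ω t n} ∩ D, f ω ∂noiseLaw c ρ := by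
  have h := lintegral_iUnion (μ := (noiseLaw c ρ).restrict D) (measurableSet_hasJumps_left t)
    (pairwise_disjoint_hasJumps t) f
  have hU : (⋃ n, {ω : ℕ → ℝ≥0 × V | HasJumps ω t n}) =ᵐ[(noiseLaw c ρ).restrict D] Set.univ := by
    refine ae_restrict_of_ae ?_
    filter_upwards [ae_exists_hasJumps c ρ t] with ω hω
    exact propext (iff_of_true (Set.mem_iUnion.2 hω) (Set.mem_univ ω))
  rw [setLIntegral_congr hU, setLIntegral_univ] at h
  rw [h]
  simp only [Measure.restrict_restrict (measurableSet_hasJumps_left t _)]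

/-- The transition operator of the jump process. -/
noncomputable def transInt (φ : S × V → S) (t : ℝ≥0) (f : S → ℝ≥0∞) (x : S) : ℝ≥0∞ :=
  ∫⁻ ω, f (path φ x ω t) ∂noiseLaw c ρ

include hφ in
theorem measurable_transInt (t : ℝ≥0) {f : S → ℝ≥0∞} (hf : Measurable f) :
    Measurable (transInt c ρ φ t f) := by
  unfold transInt
  refine Measurable.lintegral_prod_right' (f := fun q : S × (ℕ → ℝ≥0 × V) =>
    f (path φ q.1 q.2 t)) ?_
  exact hf.comp ((measurable_path hφ).comp (measurable_const.prodMk measurable_id))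

omit [MeasurableSpace S] [MeasurableSpace V] in
-- Seen from a time `s` before the first jump, the future is the same path with the first holding
-- time shortened by `s`. Memorylessness then gives the shortened time the original law.
theorem path_add_of_lt {ω : ℕ → ℝ≥0 × V} (h : NonExplosive ω) {s τ : ℝ≥0} (hs : s < τ) (t : ℝ≥0)
    (v : V) (x : S) :
    path φ x (consSeq (τ, v) ω) (s + t) = path φ x (consSeq (τ - s, v) ω) t := by
  have h1 : ∀ e : ℝ≥0 × V, NonExplosive (consSeq e ω) := fun e => nonExplosive_tailSeq.1 h
  by_cases hst : s + t < τ
  · rw [path_of_lt hst, path_of_lt]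
    exact lt_tsub_iff_left.2 hst
  · rw [not_lt] at hst
    rw [path_of_le (h1 _) (by exact hst), path_of_le (h1 _) (by exact tsub_le_iff_left.2 hst)]
    simp only [consSeq_zero, tailSeq_consSeq]
    congr 1
    rw [tsub_tsub_eq_add_tsub_of_le hs.le, add_comm]

variable {ι : Type*}

include hφ in
theorem measurableSet_pathEvent (x : S) (s : ℝ≥0) (n : ℕ) (J : Finset ι) (r : ι → ℝ≥0)
    {B : ι → Set S} (hB : ∀ i, MeasurableSet (B i)) :
    MeasurableSet {ω : ℕ → ℝ≥0 × V | HasJumps ω s n ∧ ∀ i ∈ J, path φ x ω (r i) ∈ B i} := by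
  have : {ω : ℕ → ℝ≥0 × V | HasJumps ω s n ∧ ∀ i ∈ J, path φ x ω (r i) ∈ B i} =
      {ω | HasJumps ω s n} ∩ ⋂ i ∈ J, (fun ω => path φ x ω (r i)) ⁻¹' B i := by
    ext ω
    simp
  rw [this]
  exact (measurableSet_hasJumps_left s n).inter
    (J.measurableSet_biInter fun i _ => measurable_path_right hφ (r i) x (hB i))

include hφ in
-- The number of jumps up to the present time `s` is fixed in order to induct on it. With no jump,
-- the past is constant and memorylessness applies. Otherwise condition on the first holding time
-- `τ` and mark `v`, and restart from `φ (x, v)` with `s - τ` as the present.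
theorem markov_of_hasJumps (n : ℕ) (s t : ℝ≥0) (x : S) (J : Finset ι) (r : ι → ℝ≥0)
    (hr : ∀ i ∈ J, r i ≤ s) (B : ι → Set S) (hB : ∀ i, MeasurableSet (B i)) {f : S → ℝ≥0∞}
    (hf : Measurable f) :
    ∫⁻ ω in {ω | HasJumps ω s n ∧ ∀ i ∈ J, path φ x ω (r i) ∈ B i},
        f (path φ x ω (s + t)) ∂noiseLaw c ρ =
      ∫⁻ ω in {ω | HasJumps ω s n ∧ ∀ i ∈ J, path φ x ω (r i) ∈ B i},
        transInt c ρ φ t f (path φ x ω s) ∂noiseLaw c ρ := by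
  have hm : ∀ x t, Measurable fun ω : ℕ → ℝ≥0 × V => f (path φ x ω t) := fun x t =>
    hf.comp (measurable_path_right hφ t x)
  have hm' : ∀ x s, Measurable fun ω : ℕ → ℝ≥0 × V => transInt c ρ φ t f (path φ x ω s) :=
    fun x s => (measurable_transInt c ρ hφ t hf).comp (measurable_path_right hφ s x)
  induction n generalizing s x r B with
  | zero =>
    have hpath : ∀ ω : ℕ → ℝ≥0 × V, HasJumps ω s 0 → ∀ i ∈ J, path φ x ω (r i) = x :=
      fun ω hω i hi => path_of_lt ((hr i hi).trans_lt (hasJumps_zero.1 hω)) x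
    -- Before the first jump every observation equals `x`, so the past conditions either all hold
    -- automatically or exclude everything.
    by_cases hx : ∀ i ∈ J, x ∈ B i
    swap
    · have hemp : {ω : ℕ → ℝ≥0 × V | HasJumps ω s 0 ∧ ∀ i ∈ J, path φ x ω (r i) ∈ B i} = ∅ := by
        ext ω
        simp only [Set.mem_ofPred_eq, Set.mem_empty_iff_false, iff_false]
        exact fun h => hx fun i hi => hpath ω h.1 i hi ▸ h.2 i hi
      rw [hemp]
      simp
    have hset : {ω : ℕ → ℝ≥0 × V | HasJumps ω s 0 ∧ ∀ i ∈ J, path φ x ω (r i) ∈ B i} =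
        {ω | HasJumps ω s 0} := by
      ext ω
      exact ⟨fun h => h.1, fun h => ⟨h, fun i hi => (hpath ω h i hi).symm ▸ hx i hi⟩⟩
    rw [hset]
    have hR : ∫⁻ ω in {ω | HasJumps ω s 0}, transInt c ρ φ t f (path φ x ω s) ∂noiseLaw c ρ =
        ENNReal.ofReal (poissonWeight c 0 s) * transInt c ρ φ t f x := by
      rw [setLIntegral_congr_fun (measurableSet_hasJumps_left s 0)
        (g := fun _ => transInt c ρ φ t f x)
        fun ω hω => by simp only [path_of_lt (hasJumps_zero.1 hω) x]]
      rw [setLIntegral_const, noiseLaw_hasJumps, mul_comm]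
    rw [hR, ← lintegral_indicator (measurableSet_hasJumps_left s 0),
      lintegral_noiseLaw c ρ ((hm x _).indicator (measurableSet_hasJumps_left s 0))]
    have h1 : ∀ (v : V) (τ : ℝ≥0), ∫⁻ ω, {ω | HasJumps ω s 0}.indicator
          (fun ω => f (path φ x ω (s + t))) (consSeq (τ, v) ω) ∂noiseLaw c ρ =
        (Set.Ioi s).indicator (fun τ => (fun τ' => ∫⁻ ω, f (path φ x (consSeq (τ', v) ω) t)
          ∂noiseLaw c ρ) (τ - s)) τ := by
      intro v τ
      by_cases hτ : s < τ
      · rw [Set.indicator_of_mem (Set.mem_Ioi.2 hτ)]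
        refine lintegral_congr_ae ?_
        filter_upwards [ae_nonExplosive c ρ] with ω hω
        rw [Set.indicator_of_mem (by exact hasJumps_zero.2 hτ), path_add_of_lt hω hτ]
      · rw [Set.indicator_of_notMem (by simpa using hτ)]
        simp [Set.indicator, hasJumps_zero, hτ]
    have hK : ∀ v : V, Measurable fun τ' : ℝ≥0 => ∫⁻ ω, f (path φ x (consSeq (τ', v) ω) t)
        ∂noiseLaw c ρ := by
      intro v
      refine Measurable.lintegral_prod_right' (f := fun q : ℝ≥0 × (ℕ → ℝ≥0 × V) =>
        f (path φ x (consSeq (q.1, v) q.2) t)) ?_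
      exact (hm x t).comp (measurable_consSeq.comp
        ((measurable_fst.prodMk measurable_const).prodMk measurable_snd))
    simp only [h1, lintegral_holdLaw_memoryless c s (hK _)]
    rw [lintegral_const_mul' _ _ ENNReal.ofReal_ne_top, transInt, lintegral_noiseLaw c ρ (hm x t)]
    simp [poissonWeight]
  | succ n ih =>
    have hC := measurableSet_pathEvent hφ x s (n + 1) J r hB
    rw [← lintegral_indicator hC, ← lintegral_indicator hC,
      lintegral_noiseLaw c ρ ((hm x _).indicator hC),
      lintegral_noiseLaw c ρ ((hm' x _).indicator hC)]
    refine lintegral_congr fun v => lintegral_congr fun τ => ?_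
    by_cases hτ : τ ≤ s
    swap
    · simp [Set.indicator, hasJumps_succ, hτ]
    -- An observation before `τ` sees only `x`; after the restart it becomes a condition independent
    -- of the state. This makes the truncated time `r i - τ = 0` harmless.
    have hB' : ∀ i, MeasurableSet (if r i < τ then {_y : S | x ∈ B i} else B i) := by
      intro i
      split_ifs
      · exact MeasurableSet.const _
      · exact hB i
    have hr' : ∀ i ∈ J, r i - τ ≤ s - τ := fun i hi => tsub_le_tsub_right (hr i hi) τ
    have key := ih (s - τ) (φ (x, v)) (fun i => r i - τ) hr' _ hB'
    have hC' := measurableSet_pathEvent hφ (φ (x, v)) (s - τ) n J (fun i => r i - τ) hB'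
    rw [← lintegral_indicator hC', ← lintegral_indicator hC'] at key
    have hpath : ∀ {ω : ℕ → ℝ≥0 × V}, NonExplosive ω → ∀ {q : ℝ≥0}, τ ≤ q →
        path φ x (consSeq (τ, v) ω) q = path φ (φ (x, v)) ω (q - τ) := fun hω _ hq =>
      path_of_le (nonExplosive_tailSeq.1 (by exact hω)) (by exact hq) x
    have hmem : ∀ {ω : ℕ → ℝ≥0 × V}, NonExplosive ω →
        (consSeq (τ, v) ω ∈ {ω | HasJumps ω s (n + 1) ∧ ∀ i ∈ J, path φ x ω (r i) ∈ B i} ↔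
          ω ∈ {ω | HasJumps ω (s - τ) n ∧ ∀ i ∈ J, path φ (φ (x, v)) ω (r i - τ) ∈
            if r i < τ then {_y : S | x ∈ B i} else B i}) := by
      intro ω hω
      simp only [Set.mem_ofPred_eq, hasJumps_succ, consSeq_zero, tailSeq_consSeq, hτ, true_and]
      refine and_congr_right fun _ => forall₂_congr fun i _ => ?_
      split_ifs with hi
      · rw [path_of_lt (by exact hi)]
        rfl
      · rw [hpath hω (not_lt.1 hi)]
    refine Eq.trans (lintegral_congr_ae ?_) (key.trans (lintegral_congr_ae ?_))
    · filter_upwards [ae_nonExplosive c ρ] with ω hω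
      refine indicator_eq_indicator_of_iff (hmem hω) ?_
      rw [hpath hω (hτ.trans le_self_add), tsub_add_eq_add_tsub hτ]
    · filter_upwards [ae_nonExplosive c ρ] with ω hω
      refine indicator_eq_indicator_of_iff (hmem hω).symm ?_
      rw [hpath hω hτ]

include hφ in
theorem markov_of_finset (s t : ℝ≥0) (x : S) (J : Finset ι) (r : ι → ℝ≥0)
    (hr : ∀ i ∈ J, r i ≤ s) (B : ι → Set S) (hB : ∀ i, MeasurableSet (B i)) {f : S → ℝ≥0∞}
    (hf : Measurable f) :
    ∫⁻ ω in {ω | ∀ i ∈ J, path φ x ω (r i) ∈ B i}, f (path φ x ω (s + t)) ∂noiseLaw c ρ =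
      ∫⁻ ω in {ω | ∀ i ∈ J, path φ x ω (r i) ∈ B i},
        transInt c ρ φ t f (path φ x ω s) ∂noiseLaw c ρ := by
  rw [setLIntegral_eq_tsum_hasJumps c ρ s, setLIntegral_eq_tsum_hasJumps c ρ s]
  exact tsum_congr fun n => markov_of_hasJumps c ρ hφ n s t x J r hr B hB hf

include hφ in
theorem transInt_add (s t : ℝ≥0) {f : S → ℝ≥0∞} (hf : Measurable f) (x : S) :
    transInt c ρ φ (s + t) f x = transInt c ρ φ s (transInt c ρ φ t f) x := by
  -- With no observation of the past, the Markov property is the semigroup law.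
  have h := markov_of_finset c ρ hφ s t x (∅ : Finset ℕ) (fun _ => 0) (by simp)
    (fun _ => Set.univ) (fun _ => MeasurableSet.univ) hf
  simpa [transInt] using h

end JumpLaw

/-! ### Transition kernels, the Markov process, and the Poisson series. -/

section JumpKernel

variable {S V : Type*} [MeasurableSpace S] [MeasurableSpace V]
variable (c : ℝ) [Fact (0 < c)] (ρ : Measure V) [IsProbabilityMeasure ρ]
variable {φ : S × V → S} (hφ : Measurable φ)

include hφ in
theorem measurable_noiseLaw_path {B : Set S} (hB : MeasurableSet B) :
    Measurable fun q : ℝ≥0 × S => noiseLaw c ρ {ω | path φ q.2 ω q.1 ∈ B} := by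
  have hm : Measurable fun q : (ℝ≥0 × S) × (ℕ → ℝ≥0 × V) => path φ q.1.2 q.2 q.1.1 :=
    (measurable_path hφ).comp ((measurable_fst.comp measurable_fst).prodMk
      ((measurable_snd.comp measurable_fst).prodMk measurable_snd))
  exact measurable_measure_prodMk_left (hm hB)

/-- The transition kernels of the jump process. -/
noncomputable def jumpKernel (t : ℝ≥0) : Kernel S S where
  toFun x := (noiseLaw c ρ).map fun ω => path φ x ω t
  measurable' := by
    refine Measure.measurable_of_measurable_coe _ fun B hB => ?_
    simp only [Measure.map_apply (measurable_path_right hφ t _) hB]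
    exact (measurable_noiseLaw_path c ρ hφ hB).comp measurable_prodMk_left

theorem jumpKernel_apply (t : ℝ≥0) (x : S) :
    jumpKernel c ρ hφ t x = (noiseLaw c ρ).map fun ω => path φ x ω t := rfl

theorem lintegral_jumpKernel (t : ℝ≥0) (x : S) {f : S → ℝ≥0∞} (hf : Measurable f) :
    ∫⁻ y, f y ∂jumpKernel c ρ hφ t x = transInt c ρ φ t f x := by
  rw [jumpKernel_apply, lintegral_map hf (measurable_path_right hφ t x)]
  rfl

theorem jumpKernel_eq_transInt (t : ℝ≥0) (x : S) {B : Set S} (hB : MeasurableSet B) :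
    jumpKernel c ρ hφ t x B = transInt c ρ φ t (B.indicator 1) x := by
  rw [← lintegral_indicator_one hB, lintegral_jumpKernel c ρ hφ t x (measurable_one.indicator hB)]

instance instIsMarkovKernelJumpKernel (t : ℝ≥0) : IsMarkovKernel (jumpKernel c ρ hφ t) :=
  ⟨fun x => Measure.isProbabilityMeasure_map (measurable_path_right hφ t x).aemeasurable⟩

theorem isTransitionFunction_jumpKernel : IsTransitionFunction (jumpKernel c ρ hφ) where
  isMarkovKernel := inferInstance
  zero := by
    ext x B hB
    -- A sequence may begin with a zero holding time, so the path starts at `x` only almost surely.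
    have h0 : ∀ᵐ ω ∂noiseLaw c ρ, HasJumps ω 0 0 := by
      refine (mem_ae_iff_prob_eq_one (measurableSet_hasJumps_left 0 0)).2 ?_
      have := noiseLaw_hasJumps c ρ 0 0
      simpa [poissonWeight] using this
    have h1 : (fun ω => path φ x ω 0) =ᵐ[noiseLaw c ρ] fun _ => x := by
      filter_upwards [h0] with ω hω
      exact path_of_lt (hasJumps_zero.1 hω) x
    rw [jumpKernel_apply, Measure.map_congr h1, Measure.map_const, measure_univ, one_smul,
      Kernel.id_apply]
  add := by
    intro s t
    ext x B hB
    have hi : Measurable (B.indicator (1 : S → ℝ≥0∞)) := measurable_one.indicator hB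
    rw [Kernel.comp_apply' _ _ _ hB, jumpKernel_eq_transInt c ρ hφ _ _ hB,
      transInt_add c ρ hφ s t hi, ← lintegral_jumpKernel c ρ hφ s x
        (measurable_transInt c ρ hφ t hi)]
    simp only [jumpKernel_eq_transInt c ρ hφ t _ hB]
  measurable := by
    intro B hB
    simp only [jumpKernel_apply, Measure.map_apply (measurable_path_right hφ _ _) hB]
    exact measurable_noiseLaw_path c ρ hφ hB

include hφ in
theorem measurable_path_initial (t : ℝ≥0) :
    Measurable fun w : S × (ℕ → ℝ≥0 × V) => path φ w.1 w.2 t :=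
  (measurable_path hφ).comp measurable_prodMk_left

/-- Both sides are finite measures in `C`. They agree on finite-dimensional cylinders of the past by
`markov_of_finset`, applied for each starting point, and these cylinders form a π-system generating
the past. -/
theorem setLIntegral_markov (ν : Measure S) [IsProbabilityMeasure ν] (s t : ℝ≥0)
    {B : Set S} (hB : MeasurableSet B) {C : Set (S × (ℕ → ℝ≥0 × V))}
    (hC : MeasurableSet[⨆ r ∈ Set.Iic s, MeasurableSpace.comap
      (fun w : S × (ℕ → ℝ≥0 × V) => path φ w.1 w.2 r) inferInstance] C) :
    ∫⁻ w in C, B.indicator 1 (path φ w.1 w.2 (s + t)) ∂ν.prod (noiseLaw c ρ) =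
      ∫⁻ w in C, jumpKernel c ρ hφ t (path φ w.1 w.2 s) B ∂ν.prod (noiseLaw c ρ) := by
  have hX := measurable_path_initial hφ
  have hi : Measurable (B.indicator (1 : S → ℝ≥0∞)) := measurable_one.indicator hB
  have hf : Measurable fun w : S × (ℕ → ℝ≥0 × V) =>
    B.indicator (1 : S → ℝ≥0∞) (path φ w.1 w.2 (s + t)) := hi.comp (hX _)
  have hg : Measurable fun w : S × (ℕ → ℝ≥0 × V) => jumpKernel c ρ hφ t (path φ w.1 w.2 s) B :=
    ((jumpKernel c ρ hφ t).measurable_coe hB).comp (hX s)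
  have hle : (⨆ r ∈ Set.Iic s, MeasurableSpace.comap
      (fun w : S × (ℕ → ℝ≥0 × V) => path φ w.1 w.2 r) inferInstance) ≤
      (inferInstance : MeasurableSpace (S × (ℕ → ℝ≥0 × V))) :=
    iSup₂_le fun r _ => (hX r).comap_le
  let π : ℝ≥0 → Set (Set (S × (ℕ → ℝ≥0 × V))) := fun r =>
    {A | MeasurableSet[MeasurableSpace.comap
      (fun w : S × (ℕ → ℝ≥0 × V) => path φ w.1 w.2 r) inferInstance] A}
  -- The whole space is adjoined because the uniqueness theorem for finite measures also asks for
  -- equal total masses.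
  have key : ∀ A ∈ insert Set.univ (piiUnionInter π (Set.Iic s)),
      ∫⁻ w in A, B.indicator 1 (path φ w.1 w.2 (s + t)) ∂ν.prod (noiseLaw c ρ) =
        ∫⁻ w in A, jumpKernel c ρ hφ t (path φ w.1 w.2 s) B ∂ν.prod (noiseLaw c ρ) := by
    intro A hA
    obtain ⟨J, hJ, D, hD, rfl⟩ : ∃ J : Finset ℝ≥0, (∀ r ∈ J, r ≤ s) ∧ ∃ D : ℝ≥0 → Set S,
        (∀ r, MeasurableSet (D r)) ∧
        A = {w : S × (ℕ → ℝ≥0 × V) | ∀ r ∈ J, path φ w.1 w.2 r ∈ D r} := by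
      rcases hA with rfl | ⟨J, hJ, f, hf, rfl⟩
      · exact ⟨∅, by simp, fun _ => Set.univ, fun _ => MeasurableSet.univ, by simp⟩
      · have : ∀ r, ∃ D : Set S, MeasurableSet D ∧
            (r ∈ J → (fun w : S × (ℕ → ℝ≥0 × V) => path φ w.1 w.2 r) ⁻¹' D = f r) := by
          intro r
          by_cases hr : r ∈ J
          · obtain ⟨D, hD, h⟩ := hf r hr
            exact ⟨D, hD, fun _ => h⟩
          · exact ⟨∅, MeasurableSet.empty, fun h => absurd h hr⟩
        choose D hD h using this
        refine ⟨J, fun r hr => hJ hr, D, hD, ?_⟩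
        ext w
        simp only [Set.mem_iInter, Set.mem_ofPred_eq]
        refine forall₂_congr fun r hr => ?_
        rw [← h r hr]
        rfl
    have hAm : MeasurableSet {w : S × (ℕ → ℝ≥0 × V) | ∀ r ∈ J, path φ w.1 w.2 r ∈ D r} := by
      have : {w : S × (ℕ → ℝ≥0 × V) | ∀ r ∈ J, path φ w.1 w.2 r ∈ D r} =
          ⋂ r ∈ J, (fun w => path φ w.1 w.2 r) ⁻¹' D r := by
        ext w
        simp
      rw [this]
      exact J.measurableSet_biInter fun r _ => hX r (hD r)
    rw [← lintegral_indicator hAm, ← lintegral_indicator hAm,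
      lintegral_prod _ (hf.indicator hAm).aemeasurable,
      lintegral_prod _ (hg.indicator hAm).aemeasurable]
    refine lintegral_congr fun x => ?_
    have h := markov_of_finset c ρ hφ s t x J id hJ D hD hi
    have hAx : MeasurableSet {ω : ℕ → ℝ≥0 × V | ∀ r ∈ J, path φ x ω (id r) ∈ D r} :=
      measurable_prodMk_left (x := x) hAm
    rw [← lintegral_indicator hAx, ← lintegral_indicator hAx] at h
    simp only [← jumpKernel_eq_transInt c ρ hφ t _ hB] at h
    exact h
  have hfin : IsFiniteMeasure ((ν.prod (noiseLaw c ρ)).withDensity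
      fun w => B.indicator 1 (path φ w.1 w.2 (s + t))) := by
    refine isFiniteMeasure_withDensity (ne_top_of_le_ne_top ENNReal.one_ne_top ?_)
    refine (lintegral_mono (g := fun _ => 1) fun w => ?_).trans (by simp)
    exact Set.indicator_le_self' (f := (1 : S → ℝ≥0∞)) (fun _ _ => zero_le) _
  have h := ext_on_measurableSpace_of_generate_finite
    (μ := (ν.prod (noiseLaw c ρ)).withDensity
      fun w => B.indicator 1 (path φ w.1 w.2 (s + t)))
    (ν := (ν.prod (noiseLaw c ρ)).withDensity
      fun w => jumpKernel c ρ hφ t (path φ w.1 w.2 s) B)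
    (m₀ := inferInstance) (piiUnionInter π (Set.Iic s)) ?_ hle
    (generateFrom_piiUnionInter_measurableSet (fun r => MeasurableSpace.comap
      (fun w : S × (ℕ → ℝ≥0 × V) => path φ w.1 w.2 r) inferInstance) (Set.Iic s)).symm
    (isPiSystem_piiUnionInter π (fun r => @MeasurableSpace.isPiSystem_measurableSet _
      (MeasurableSpace.comap (fun w : S × (ℕ → ℝ≥0 × V) => path φ w.1 w.2 r) inferInstance)) _)
    ?_ hC
  · rwa [withDensity_apply _ (hle _ hC), withDensity_apply _ (hle _ hC)] at h
  · intro A hA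
    have hAm : MeasurableSet A := hle _ (by
      rw [← generateFrom_piiUnionInter_measurableSet]
      exact MeasurableSpace.measurableSet_generateFrom hA)
    rw [withDensity_apply _ hAm, withDensity_apply _ hAm]
    exact key A (Set.mem_insert_of_mem _ hA)
  · rw [withDensity_apply _ MeasurableSet.univ, withDensity_apply _ MeasurableSet.univ]
    exact key _ (Set.mem_insert _ _)

theorem isMarkovProcess_path (ν : Measure S) [IsProbabilityMeasure ν] :
    IsMarkovProcess (ν.prod (noiseLaw c ρ)) (jumpKernel c ρ hφ) ν
      (fun t (w : S × (ℕ → ℝ≥0 × V)) => path φ w.1 w.2 t) where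
  isProbabilityMeasure := inferInstance
  measurable := measurable_path_initial hφ
  initial := by
    have h0 : ∀ᵐ ω ∂noiseLaw c ρ, HasJumps ω 0 0 := by
      refine (mem_ae_iff_prob_eq_one (measurableSet_hasJumps_left 0 0)).2 ?_
      have := noiseLaw_hasJumps c ρ 0 0
      simpa [poissonWeight] using this
    have h1 : (fun w : S × (ℕ → ℝ≥0 × V) => path φ w.1 w.2 0)
        =ᵐ[ν.prod (noiseLaw c ρ)] Prod.fst := by
      filter_upwards [Measure.quasiMeasurePreserving_snd.ae h0] with w hw
      exact path_of_lt (hasJumps_zero.1 hw) w.1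
    rw [Measure.map_congr h1, Measure.map_fst_prod, measure_univ, one_smul]
  markov := by
    intro s t B hB
    have hX := measurable_path_initial hφ
    have hle : (⨆ r ∈ Set.Iic s, MeasurableSpace.comap
        (fun w : S × (ℕ → ℝ≥0 × V) => path φ w.1 w.2 r) inferInstance) ≤
        (inferInstance : MeasurableSpace (S × (ℕ → ℝ≥0 × V))) :=
      iSup₂_le fun r _ => (hX r).comap_le
    have hXs : Measurable[⨆ r ∈ Set.Iic s, MeasurableSpace.comap
        (fun w : S × (ℕ → ℝ≥0 × V) => path φ w.1 w.2 r) inferInstance]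
        fun w => path φ w.1 w.2 s :=
      (comap_measurable _).mono (le_iSup₂_of_le s (Set.mem_Iic.2 le_rfl) le_rfl) le_rfl
    have hk : Measurable fun y => (jumpKernel c ρ hφ t y).real B :=
      ((jumpKernel c ρ hφ t).measurable_coe hB).ennreal_toReal
    have hgi : Integrable (fun w : S × (ℕ → ℝ≥0 × V) =>
        (jumpKernel c ρ hφ t (path φ w.1 w.2 s)).real B) (ν.prod (noiseLaw c ρ)) := by
      refine Integrable.of_bound (C := 1) (hk.comp (hX s)).aestronglyMeasurable
        (ae_of_all _ fun w => ?_)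
      rw [Real.norm_of_nonneg measureReal_nonneg]
      exact measureReal_le_one
    have hBm := hX (s + t) hB
    refine (ae_eq_condExp_of_forall_setIntegral_eq hle
      ((integrable_const (1 : ℝ)).indicator hBm) (fun C _ _ => hgi.integrableOn) ?_
      (hk.comp hXs).stronglyMeasurable.aestronglyMeasurable).symm
    intro C hC _
    rw [integral_eq_lintegral_of_nonneg_ae (ae_of_all _ fun w => measureReal_nonneg)
        (hk.comp (hX s)).aestronglyMeasurable,
      integral_eq_lintegral_of_nonneg_ae
        (ae_of_all _ fun w => Set.indicator_nonneg (fun _ _ => zero_le_one) w)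
        (measurable_const.indicator hBm).aestronglyMeasurable]
    congr 1
    simp only [ofReal_measureReal (measure_ne_top (jumpKernel c ρ hφ t _) B)]
    rw [← setLIntegral_markov c ρ hφ ν s t hB hC]
    refine lintegral_congr fun w => ?_
    by_cases hw : path φ w.1 w.2 (s + t) ∈ B
    · rw [Set.indicator_of_mem hw, Set.indicator_of_mem (by exact hw)]
      simp
    · rw [Set.indicator_of_notMem hw, Set.indicator_of_notMem (by exact hw)]
      simp

/-- Split the expectation by the number of jumps up to `t`; on each piece the path sits at the
chain, which is independent of the clock. -/
theorem hasSum_integral_jumpKernel (t : ℝ≥0) (x : S) {f : S → ℝ} (hf : Measurable f) {C : ℝ}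
    (hC : ∀ y, |f y| ≤ C) :
    HasSum (fun n => poissonWeight c n t * ∫ ω, f (chain φ n x ω) ∂noiseLaw c ρ)
      (∫ y, f y ∂jumpKernel c ρ hφ t x) := by
  have hch : ∀ n, Measurable fun ω : ℕ → ℝ≥0 × V => chain φ n x ω := fun n =>
    (measurable_chain hφ n).comp measurable_prodMk_left
  have hfp : Measurable fun ω : ℕ → ℝ≥0 × V => f (path φ x ω t) :=
    hf.comp (measurable_path_right hφ t x)
  have hint : Integrable (fun ω : ℕ → ℝ≥0 × V => f (path φ x ω t)) (noiseLaw c ρ) :=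
    Integrable.of_bound hfp.aestronglyMeasurable C (ae_of_all _ fun ω => hC _)
  have h := hasSum_integral_iUnion (measurableSet_hasJumps_left t) (pairwise_disjoint_hasJumps t)
    (hint.integrableOn (s := ⋃ n, {ω | HasJumps ω t n}))
  have hU : (⋃ n, {ω : ℕ → ℝ≥0 × V | HasJumps ω t n}) =ᵐ[noiseLaw c ρ] Set.univ := by
    filter_upwards [ae_exists_hasJumps c ρ t] with ω hω
    exact propext (iff_of_true (Set.mem_iUnion.2 hω) (Set.mem_univ ω))
  rw [setIntegral_congr_set hU, setIntegral_univ] at h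
  rw [jumpKernel_apply, integral_map (measurable_path_right hφ t x).aemeasurable
    hf.aestronglyMeasurable]
  refine h.congr_fun fun n => Eq.symm ?_
  have h1 : ∫ ω in {ω | HasJumps ω t n}, f (path φ x ω t) ∂noiseLaw c ρ =
      ∫ ω in {ω | HasJumps ω t n}, f (chain φ n x ω) ∂noiseLaw c ρ := by
    refine setIntegral_congr_ae (measurableSet_hasJumps_left t n) ?_
    filter_upwards [ae_nonExplosive c ρ] with ω hω hn
    rw [path_of_hasJumps hω hn]
  -- Independence is known for nonnegative integrands; as an identity of measures it also applies to
  -- the signed `f`.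
  have h2 : ((noiseLaw c ρ).restrict {ω | HasJumps ω t n}).map (chain φ n x) =
      ENNReal.ofReal (poissonWeight c n t) • (noiseLaw c ρ).map (chain φ n x) := by
    ext B hB
    have hi : Measurable (B.indicator (1 : S → ℝ≥0∞)) := measurable_one.indicator hB
    have := setLIntegral_hasJumps_chain c ρ hφ n t x hi
    rw [← lintegral_map hi (hch n), ← lintegral_map hi (hch n), lintegral_indicator_one hB,
      lintegral_indicator_one hB] at this
    exact this
  rw [h1, ← integral_map (μ := (noiseLaw c ρ).restrict _) (hch n).aemeasurable hf.aestronglyMeasurable, h2,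
    integral_smul_measure, integral_map (hch n).aemeasurable hf.aestronglyMeasurable,
    ENNReal.toReal_ofReal (poissonWeight_nonneg (Fact.out : 0 < c).le n t.coe_nonneg), smul_eq_mul]

include hφ in
theorem integral_chain_succ (n : ℕ) (x : S) {f : S → ℝ} (hf : Measurable f) {C : ℝ}
    (hC : ∀ y, |f y| ≤ C) :
    ∫ ω, f (chain φ (n + 1) x ω) ∂noiseLaw c ρ =
      ∫ v, ∫ ω, f (chain φ n (φ (x, v)) ω) ∂noiseLaw c ρ ∂ρ := by
  have hm : Measurable fun ω : ℕ → ℝ≥0 × V => f (chain φ (n + 1) x ω) :=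
    hf.comp ((measurable_chain hφ (n + 1)).comp measurable_prodMk_left)
  have hm2 : Measurable fun q : (ℝ≥0 × V) × (ℕ → ℝ≥0 × V) => f (chain φ n (φ (x, q.1.2)) q.2) :=
    hm.comp measurable_consSeq
  have hi : Integrable (fun q : (ℝ≥0 × V) × (ℕ → ℝ≥0 × V) => f (chain φ n (φ (x, q.1.2)) q.2))
      (((holdLaw c).prod ρ).prod (noiseLaw c ρ)) :=
    Integrable.of_bound hm2.aestronglyMeasurable C (ae_of_all _ fun q => hC _)
  have h := map_consSeq_infinitePi ((holdLaw c).prod ρ)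
  change (((holdLaw c).prod ρ).prod (noiseLaw c ρ)).map _ = noiseLaw c ρ at h
  conv_lhs => rw [← h]
  rw [integral_map measurable_consSeq.aemeasurable hm.aestronglyMeasurable]
  change ∫ q : (ℝ≥0 × V) × (ℕ → ℝ≥0 × V), f (chain φ n (φ (x, q.1.2)) q.2)
    ∂(((holdLaw c).prod ρ).prod (noiseLaw c ρ)) = _
  rw [integral_prod _ hi]
  have h2 := integral_fun_snd (μ := holdLaw c) (ν := ρ)
    (fun v => ∫ ω, f (chain φ n (φ (x, v)) ω) ∂noiseLaw c ρ)
  simpa using h2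

end JumpKernel

/-! ### Möbius transformations are homeomorphisms of the projective line. -/

section MoebiusContinuity

variable {K : Type u} [NontriviallyNormedField K]

open Classical in
theorem mk_smul_coe (A : Matrix.GeneralLinearGroup (Fin 2) K) (z : K) :
    (Matrix.ProjGenLinGroup.mk A : PGL2 K) • (z : OnePoint K) =
      if A 1 0 * z + A 1 1 = 0 then OnePoint.infty
      else (((A 0 0 * z + A 0 1) / (A 1 0 * z + A 1 1) : K) : OnePoint K) := by
  change letI : DecidableEq K := Classical.decEq K
    A • (z : OnePoint K) = _
  rw [OnePoint.smul_some_eq_ite]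

open Classical in
theorem mk_smul_infty (A : Matrix.GeneralLinearGroup (Fin 2) K) :
    (Matrix.ProjGenLinGroup.mk A : PGL2 K) • (OnePoint.infty : OnePoint K) =
      if A 1 0 = 0 then OnePoint.infty else ((A 0 0 / A 1 0 : K) : OnePoint K) := by
  change letI : DecidableEq K := Classical.decEq K
    A • (OnePoint.infty : OnePoint K) = _
  rw [OnePoint.smul_infty_eq_ite]

variable [ProperSpace K]

theorem coclosedCompact_eq_cobounded : coclosedCompact K = Bornology.cobounded K := by
  rw [coclosedCompact_eq_cocompact, Metric.cobounded_eq_cocompact]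

theorem tendsto_coe_cobounded :
    Tendsto ((↑) : K → OnePoint K) (Bornology.cobounded K) (𝓝 OnePoint.infty) := by
  rw [← coclosedCompact_eq_cobounded]
  exact OnePoint.tendsto_coe_infty

open Classical in
theorem tendsto_inv_onePoint :
    Tendsto (fun w : K => if w = 0 then OnePoint.infty else ((w⁻¹ : K) : OnePoint K)) (𝓝 0)
      (𝓝 OnePoint.infty) := by
  rw [← nhdsNE_sup_pure, tendsto_sup]
  constructor
  · refine (tendsto_coe_cobounded.comp tendsto_inv₀_nhdsNE_zero).congr' ?_
    filter_upwards [self_mem_nhdsWithin] with w hw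
    have hw' : w ≠ 0 := hw
    simp [hw']
  · rw [tendsto_pure_left]
    intro s hs
    simpa using mem_of_mem_nhds hs

theorem continuous_smul_PGL2 (γ : PGL2 K) : Continuous fun x : OnePoint K => γ • x := by
  classical
  obtain ⟨A, rfl⟩ := Matrix.ProjGenLinGroup.mk_surjective γ
  have hdet : A 0 0 * A 1 1 - A 0 1 * A 1 0 ≠ 0 := by
    have := A.det_ne_zero
    rwa [Matrix.det_fin_two] at this
  refine (OnePoint.continuous_iff _).2 ⟨?_, continuous_iff_continuousAt.2 fun z => ?_⟩
  · rw [coclosedCompact_eq_cobounded, mk_smul_infty]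
    simp only [mk_smul_coe]
    by_cases hc : A 1 0 = 0
    · have hd : A 1 1 ≠ 0 := fun h => hdet (by rw [h, hc]; ring)
      have ha : A 0 0 ≠ 0 := fun h => hdet (by rw [h, hc]; ring)
      simp only [hc, zero_mul, zero_add, hd, if_false, if_true]
      have h := ((tendsto_mul_right_cobounded (inv_ne_zero hd)).comp
        ((tendsto_add_const_cobounded (A 0 1)).comp (tendsto_mul_left_cobounded ha)))
      refine (tendsto_coe_cobounded.comp h).congr fun z => ?_
      simp [div_eq_mul_inv]
    · simp only [hc, if_false]
      have hden : Tendsto (fun z => A 1 0 * z + A 1 1) (Bornology.cobounded K)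
          (Bornology.cobounded K) :=
        (tendsto_add_const_cobounded (A 1 1)).comp (tendsto_mul_left_cobounded hc)
      have hne : ∀ᶠ z in Bornology.cobounded K, A 1 0 * z + A 1 1 ≠ 0 :=
        hden.eventually_ne_cobounded 0
      -- Polynomial division writes the map as its value at `∞` plus a multiple of `1 / (c z + d)`,
      -- which tends to zero.
      have h : Tendsto (fun z => A 0 0 / A 1 0 +
          (A 0 1 - A 0 0 * A 1 1 / A 1 0) * (A 1 0 * z + A 1 1)⁻¹) (Bornology.cobounded K)
          (𝓝 (A 0 0 / A 1 0 + (A 0 1 - A 0 0 * A 1 1 / A 1 0) * 0)) :=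
        tendsto_const_nhds.add (tendsto_const_nhds.mul (tendsto_inv₀_cobounded.comp hden))
      rw [mul_zero, add_zero] at h
      refine ((OnePoint.continuous_coe.tendsto _).comp h).congr' ?_
      filter_upwards [hne] with z hz
      rw [if_neg hz]
      simp only [Function.comp_apply, OnePoint.coe_eq_coe]
      field_simp
      ring
  · have hd : ContinuousAt (fun z => A 1 0 * z + A 1 1) z := by fun_prop
    have hn : ContinuousAt (fun z => A 0 0 * z + A 0 1) z := by fun_prop
    by_cases hz : A 1 0 * z + A 1 1 = 0
    -- Numerator and denominator cannot both vanish, since the determinant is nonzero; so near the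
    -- pole the map is the inverse of a function tending to zero.
    · have hz' : A 0 0 * z + A 0 1 ≠ 0 := by
        intro h
        by_cases hc : A 1 0 = 0
        · rw [hc, zero_mul, zero_add] at hz
          exact hdet (by rw [hz, hc]; ring)
        · refine hdet ?_
          have h1 : A 1 1 = -(A 1 0 * z) := by linear_combination hz
          have h2 : A 0 1 = -(A 0 0 * z) := by linear_combination h
          rw [h1, h2]
          ring
      have hw : Tendsto (fun y => (A 1 0 * y + A 1 1) / (A 0 0 * y + A 0 1)) (𝓝 z) (𝓝 0) := by
        have := hd.tendsto.div hn.tendsto hz'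
        rwa [hz, zero_div] at this
      have h := tendsto_inv_onePoint.comp hw
      rw [ContinuousAt, mk_smul_coe, if_pos hz]
      refine h.congr' ?_
      filter_upwards [hn.eventually_ne hz'] with y hy
      simp only [Function.comp_apply, mk_smul_coe, div_eq_zero_iff, hy, or_false, inv_div]
    · have h : ContinuousAt (fun y => (((A 0 0 * y + A 0 1) / (A 1 0 * y + A 1 1) : K) :
          OnePoint K)) z :=
        ContinuousAt.comp (f := fun y => (A 0 0 * y + A 0 1) / (A 1 0 * y + A 1 1))
          OnePoint.continuous_coe.continuousAt (hn.div hd hz)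
      refine h.congr ?_
      filter_upwards [hd.eventually_ne hz] with y hy
      rw [mk_smul_coe, if_neg hy]

instance instContinuousConstSMulPGL2 : ContinuousConstSMul (PGL2 K) (OnePoint K) :=
  ⟨continuous_smul_PGL2⟩

end MoebiusContinuity

/-! ### Reduction of regular points to the fundamental domain. -/

section Reduction

variable {K : Type u} [NontriviallyNormedField K] {Γ : Subgroup (PGL2 K)} {F : Set K}

theorem isOpen_regularSet (Γ : Subgroup (PGL2 K)) : IsOpen (regularSet Γ) :=
  isClosed_closure.isOpen_compl

/-- The element of `Γ` moving the fundamental domain over a given regular point. -/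
noncomputable def tileElt (hF : IsFundDomain Γ F) (x : regularSet Γ) : Γ :=
  (hF.existsUnique x x.2).choose

theorem exists_tileElt_smul (hF : IsFundDomain Γ F) (x : regularSet Γ) :
    ∃ z ∈ F, (tileElt hF x : PGL2 K) • (z : OnePoint K) = x :=
  (hF.existsUnique x x.2).choose_spec.1

/-- The representative in the fundamental domain of a regular point. -/
noncomputable def tileRep (hF : IsFundDomain Γ F) (x : regularSet Γ) : K :=
  (exists_tileElt_smul hF x).choose

theorem tileRep_mem (hF : IsFundDomain Γ F) (x : regularSet Γ) : tileRep hF x ∈ F :=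
  (exists_tileElt_smul hF x).choose_spec.1

theorem tileElt_smul_tileRep (hF : IsFundDomain Γ F) (x : regularSet Γ) :
    (tileElt hF x : PGL2 K) • ((tileRep hF x : K) : OnePoint K) = x :=
  (exists_tileElt_smul hF x).choose_spec.2

theorem tileElt_eq (hF : IsFundDomain Γ F) {x : regularSet Γ} {γ : Γ} {z : K} (hz : z ∈ F)
    (h : (γ : PGL2 K) • (z : OnePoint K) = x) : tileElt hF x = γ :=
  ((hF.existsUnique x x.2).choose_spec.2 γ ⟨z, hz, h⟩).symm

theorem tileRep_eq (hF : IsFundDomain Γ F) {x : regularSet Γ} {γ : Γ} {z : K} (hz : z ∈ F)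
    (h : (γ : PGL2 K) • (z : OnePoint K) = x) : tileRep hF x = z := by
  have h1 := tileElt_smul_tileRep hF x
  rw [tileElt_eq hF hz h, ← h] at h1
  exact OnePoint.coe_injective (smul_left_cancel _ h1)

theorem tileRep_eq_of_smul_eq (hF : IsFundDomain Γ F) {γ : PGL2 K} (hγ : γ ∈ Γ)
    {x y : regularSet Γ} (h : γ • (x : OnePoint K) = y) : tileRep hF y = tileRep hF x := by
  refine tileRep_eq hF (γ := ⟨γ, hγ⟩ * tileElt hF x) (tileRep_mem hF x) ?_
  rw [Subgroup.coe_mul, mul_smul, tileElt_smul_tileRep, h]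

variable [ProperSpace K]

theorem isOpen_translate (γ : PGL2 K) {V : Set K} (hV : IsOpen V) : IsOpen (translate γ V) := by
  have : translate γ V = (fun x : OnePoint K => γ • x) '' (((↑) : K → OnePoint K) '' V) := by
    rw [Set.image_image]
    rfl
  rw [this]
  exact isOpenMap_smul γ _ (OnePoint.isOpen_image_coe.2 hV)

theorem isCompact_translate (γ : PGL2 K) {V : Set K} (hV : IsCompact V) :
    IsCompact (translate γ V) :=
  hV.image ((continuous_const_smul γ).comp OnePoint.continuous_coe)

/-- The tiles are open, and on the tile of `x` the representative is obtained by applying one fixed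
group element. -/
theorem continuous_tileRep (hF : IsFundDomain Γ F) : Continuous (tileRep hF) := by
  refine OnePoint.isOpenEmbedding_coe.isEmbedding.continuous_iff.2
    (continuous_iff_continuousAt.2 fun x => ?_)
  have h1 : ContinuousAt (fun y : regularSet Γ =>
      (tileElt hF x : PGL2 K)⁻¹ • (y : OnePoint K)) x :=
    ((continuous_const_smul _).comp continuous_subtype_val).continuousAt
  refine h1.congr ?_
  have h2 : Subtype.val ⁻¹' translate (tileElt hF x : PGL2 K) F ∈ 𝓝 x :=
    ((isOpen_translate _ hF.isOpen).preimage continuous_subtype_val).mem_nhds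
      ⟨_, tileRep_mem hF x, tileElt_smul_tileRep hF x⟩
  filter_upwards [h2] with y hy
  obtain ⟨z, hz, hzy⟩ := hy
  have hzy' : (tileElt hF x : PGL2 K) • (z : OnePoint K) = y := hzy
  rw [Function.comp_apply, tileRep_eq hF hz hzy', ← hzy', inv_smul_smul]

end Reduction

/-! ### The invariant kernel: collapse of the double sum, continuity, bounds. -/

section Kernel

variable {K : Type u} [NontriviallyNormedField K] {Γ : Subgroup (PGL2 K)} {F : Set K}
variable {ι : Type*} {U : ι → Set K}

theorem IsVerticialCovering.subset (hU : IsVerticialCovering F U) (i : ι) : U i ⊆ F :=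
  hU.iUnion_eq ▸ Set.subset_iUnion U i

theorem IsVerticialCovering.exists_mem (hU : IsVerticialCovering F U) {z : K} (hz : z ∈ F) :
    ∃ i, z ∈ U i := by
  rw [← hU.iUnion_eq] at hz
  exact Set.mem_iUnion.1 hz

theorem IsVerticialCovering.eq_of_mem (hU : IsVerticialCovering F U) {z : K} {i j : ι}
    (hi : z ∈ U i) (hj : z ∈ U j) : i = j := by
  by_contra h
  exact Set.disjoint_left.1 (hU.disjoint h) hi hj

theorem IsVerticialCovering.isClosed (hU : IsVerticialCovering F U) (i : ι) :
    IsClosed (U i) := by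
  obtain ⟨C, r, -, -, h⟩ := hU.spheres i
  rw [h]
  exact isClosed_biInter fun c _ => Metric.isClosed_sphere

theorem IsVerticialCovering.isOpen [IsUltrametricDist K] (hU : IsVerticialCovering F U) (i : ι) :
    IsOpen (U i) := by
  obtain ⟨C, r, -, hr, h⟩ := hU.spheres i
  rw [h]
  exact isOpen_biInter_finset fun c _ => IsUltrametricDist.isOpen_sphere c hr.ne'

theorem IsVerticialCovering.isCompact (hU : IsVerticialCovering F U) (hF : IsCompact F) (i : ι) :
    IsCompact (U i) := hF.of_isClosed_subset (hU.isClosed i) (hU.subset i)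

variable [Fintype ι] (U) (A : Matrix ι ι ℝ) (α : ℝ)

open Classical in
theorem baseKernel_coe (u v : K) : baseKernel U A α (u : OnePoint K) v =
    ∑ i, ∑ j, if u ∈ U i ∧ v ∈ U j then A i j * ‖u - v‖ ^ α else 0 := by
  simp [baseKernel, absDiff]

variable {U A α}

theorem baseKernel_of_mem (hU : IsVerticialCovering F U) {u v : K} {i j : ι} (hu : u ∈ U i)
    (hv : v ∈ U j) : baseKernel U A α (u : OnePoint K) v = A i j * ‖u - v‖ ^ α := by
  classical
  rw [baseKernel_coe, Finset.sum_eq_single i, Finset.sum_eq_single j]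
  · rw [if_pos ⟨hu, hv⟩]
  · exact fun k _ hk => if_neg fun h => hk (hU.eq_of_mem h.2 hv)
  · simp
  · exact fun k _ hk => Finset.sum_eq_zero fun l _ => if_neg fun h => hk (hU.eq_of_mem h.1 hu)
  · simp

theorem baseKernel_nonneg (hA : ∀ i j, 0 ≤ A i j) (u v : K) :
    0 ≤ baseKernel U A α (u : OnePoint K) v := by
  classical
  rw [baseKernel_coe]
  refine Finset.sum_nonneg fun i _ => Finset.sum_nonneg fun j _ => ?_
  split_ifs
  · exact mul_nonneg (hA i j) (Real.rpow_nonneg (norm_nonneg _) _)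
  · exact le_rfl

/-- A term is nonzero only if `γ` and `δ` carry `F` over `x` and `y`, and uniqueness of the tile
leaves a single pair. -/
theorem invKernel_eq (hF : IsFundDomain Γ F) (hU : IsVerticialCovering F U) (x y : regularSet Γ) :
    invKernel Γ U A α x y =
      baseKernel U A α ((tileRep hF x : K) : OnePoint K) ((tileRep hF y : K) : OnePoint K) := by
  classical
  have hinv : ∀ x : regularSet Γ, (tileElt hF x)⁻¹ • (x : OnePoint K) = tileRep hF x := by
    intro x
    rw [inv_smul_eq_iff]
    exact (tileElt_smul_tileRep hF x).symm
  have hne : ∀ (x : regularSet Γ) (γ : Γ), γ ≠ tileElt hF x → ∀ i,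
      ¬ (γ⁻¹ • (x : OnePoint K) ∈ ((↑) : K → OnePoint K) '' U i) := by
    rintro x γ hγ i ⟨z, hz, hzx⟩
    refine hγ (tileElt_eq hF (hU.subset i hz) ?_).symm
    rw [hzx]
    exact smul_inv_smul γ _
  rw [invKernel, tsum_eq_single (tileElt hF x), tsum_eq_single (tileElt hF y), hinv, hinv]
  · intro δ hδ
    refine Finset.sum_eq_zero fun i _ => Finset.sum_eq_zero fun j _ => if_neg fun h => ?_
    exact hne y δ hδ j h.2
  · intro γ hγ
    have h0 : ∀ δ : Γ, baseKernel U A α (γ⁻¹ • (x : OnePoint K)) (δ⁻¹ • (y : OnePoint K)) = 0 := by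
      intro δ
      refine Finset.sum_eq_zero fun i _ => Finset.sum_eq_zero fun j _ => if_neg fun h => ?_
      exact hne x γ hγ i h.1
    simp only [h0, tsum_zero]

  
variable [IsUltrametricDist K]

/-- The sets `U i` are open, so locally only one pair `(i, j)` matters. For `i = j` the coefficient
is zero; for `i ≠ j` the points differ, so the power is continuous even when `α < 0`. -/
theorem continuousOn_baseKernel (hU : IsVerticialCovering F U) (hA : ∀ i, A i i = 0) :
    ContinuousOn (fun q : K × K => baseKernel U A α (q.1 : OnePoint K) q.2) (F ×ˢ F) := by
  rintro ⟨u, v⟩ ⟨hu, hv⟩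
  obtain ⟨i, hi⟩ := hU.exists_mem hu
  obtain ⟨j, hj⟩ := hU.exists_mem hv
  refine ContinuousAt.continuousWithinAt ?_
  have h : ContinuousAt (fun q : K × K => A i j * ‖q.1 - q.2‖ ^ α) (u, v) := by
    by_cases hij : i = j
    · subst hij
      simp only [hA, zero_mul]
      exact continuousAt_const
    · have huv : u - v ≠ 0 := fun h => hij (hU.eq_of_mem hi (sub_eq_zero.1 h ▸ hj))
      have h1 : ContinuousAt (fun q : K × K => ‖q.1 - q.2‖) (u, v) := by fun_prop
      exact continuousAt_const.mul (h1.rpow_const (Or.inl (norm_ne_zero_iff.2 huv)))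
  refine h.congr ?_
  filter_upwards [((hU.isOpen i).prod (hU.isOpen j)).mem_nhds ⟨hi, hj⟩] with q hq
  exact (baseKernel_of_mem hU hq.1 hq.2).symm

theorem exists_bound_baseKernel (hF : IsFundDomain Γ F) (hU : IsVerticialCovering F U)
    (hA : ∀ i, A i i = 0) :
    ∃ M : ℝ, ∀ u ∈ F, ∀ v ∈ F, |baseKernel U A α (u : OnePoint K) v| ≤ M := by
  obtain ⟨M, hM⟩ := (hF.isCompact.prod hF.isCompact).exists_bound_of_continuousOn
    (continuousOn_baseKernel (α := α) hU hA)
  exact ⟨M, fun u hu v hv => hM (u, v) ⟨hu, hv⟩⟩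

theorem measurable_baseKernel [MeasurableSpace K] [BorelSpace K] [ProperSpace K]
    (hU : IsVerticialCovering F U) :
    Measurable fun q : K × K => baseKernel U A α (q.1 : OnePoint K) q.2 := by
  classical
  simp only [baseKernel_coe]
  refine Finset.measurable_sum _ fun i _ => Finset.measurable_sum _ fun j _ => ?_
  refine Measurable.ite ?_ ?_ measurable_const
  · exact (measurable_fst (hU.isClosed i).measurableSet).inter
      (measurable_snd (hU.isClosed j).measurableSet)
  · exact ((measurable_fst.sub measurable_snd).norm.pow_const α).const_mul _

end Kernel

/-! ### Finiteness of the weighted measure when `∞` is regular. -/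

section FiniteMeasure

variable {K : Type u} [NontriviallyNormedField K] [MeasurableSpace K] {ι : Type*}

/-- The mass of the translate `γ V` for the weighted measure. -/
noncomputable def tileMass (μ : Measure K) (s : ℝ) (γ : PGL2 K) (V : Set K) : ℝ≥0∞ :=
  weight γ V ^ (-s) * μ (((↑) : K → OnePoint K) ⁻¹' translate γ V)

omit [MeasurableSpace K] in
theorem weight_rpow_le_one (γ : PGL2 K) (V : Set K) {s : ℝ} (hs : 0 < s) :
    weight γ V ^ (-s) ≤ 1 := by
  rw [ENNReal.rpow_neg]
  exact ENNReal.inv_le_one.2 (ENNReal.one_le_rpow (le_max_left _ _) hs)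

omit [MeasurableSpace K] in
theorem weight_rpow_eq_zero {γ : PGL2 K} {V : Set K} {z : K} (hz : z ∈ V)
    (h : γ • (z : OnePoint K) = OnePoint.infty) {s : ℝ} (hs : 0 < s) : weight γ V ^ (-s) = 0 := by
  have h1 : derivAbs γ z = ∞ := by
    obtain ⟨A, rfl⟩ := Matrix.ProjGenLinGroup.mk_surjective γ
    rw [mk_smul_coe] at h
    have h0 : A 1 0 * z + A 1 1 = 0 := by
      by_contra hne
      rw [if_neg hne] at h
      exact OnePoint.coe_ne_infty _ h
    rw [derivAbs_mk, glDerivAbs, h0]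
    have hdet : ‖A.val.det‖ₑ ≠ 0 := enorm_ne_zero.2 A.det_ne_zero
    simp only [enorm_zero, ne_eq, OfNat.ofNat_ne_zero, not_false_eq_true, zero_pow]
    exact ENNReal.div_zero hdet
  have h2 : weight γ V = ∞ := by
    refine top_le_iff.1 (le_trans ?_ (le_max_right _ _))
    rw [← h1]
    exact le_iSup₂ (f := fun z (_ : z ∈ V) => derivAbs γ z) z hz
  rw [h2, ENNReal.top_rpow_of_neg (neg_lt_zero.2 hs)]

variable [BorelSpace K]

theorem measurable_coe_onePoint : Measurable ((↑) : K → OnePoint K) :=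
  OnePoint.continuous_coe.measurable

omit [BorelSpace K] in
theorem weightedMeasure_univ (μ : Measure K) (Γ : Subgroup (PGL2 K)) (U : ι → Set K) (s : ℝ) :
    weightedMeasure μ Γ U s Set.univ = ∑' q : Γ × ι, weight (q.1 : PGL2 K) (U q.2) ^ (-s) *
      μ.map ((↑) : K → OnePoint K) (regularSet Γ ∩ translate (q.1 : PGL2 K) (U q.2)) := by
  have hm := (isOpen_regularSet Γ).measurableSet
  rw [weightedMeasure, (MeasurableEmbedding.subtype_coe hm).comap_apply, Set.image_univ,
    Subtype.range_coe, Measure.sum_apply _ hm]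
  refine tsum_congr fun q => ?_
  rw [Measure.smul_apply, Measure.restrict_apply hm, smul_eq_mul]

theorem weightedMeasure_univ_le (μ : Measure K) (Γ : Subgroup (PGL2 K)) {U : ι → Set K} (s : ℝ)
    (hU : ∀ (γ : PGL2 K) (i : ι), MeasurableSet (translate γ (U i))) :
    weightedMeasure μ Γ U s Set.univ ≤ ∑' q : Γ × ι, tileMass μ s (q.1 : PGL2 K) (U q.2) := by
  rw [weightedMeasure_univ]
  refine ENNReal.tsum_le_tsum fun q => mul_le_mul_right ?_ _
  rw [← Measure.map_apply measurable_coe_onePoint (hU _ _)]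
  exact measure_mono Set.inter_subset_right

variable [ProperSpace K] [IsUltrametricDist K] {Γ : Subgroup (PGL2 K)} {F : Set K} {U : ι → Set K}
variable (μ : Measure K) [μ.IsAddHaarMeasure]

omit [BorelSpace K] [ProperSpace K] [IsUltrametricDist K] in
theorem measure_preimage_coe_lt_top {C : Set (OnePoint K)} (hC : IsClosed C)
    (h : OnePoint.infty ∉ C) : μ (((↑) : K → OnePoint K) ⁻¹' C) < ∞ :=
  ((OnePoint.isClosed_iff_of_notMem h).1 hC).2.measure_lt_top

omit [BorelSpace K] [IsUltrametricDist K] in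
theorem tileMass_lt_top {γ : PGL2 K} {V : Set K} (hV : IsCompact V) {s : ℝ} (hs : 0 < s) :
    tileMass μ s γ V < ∞ := by
  by_cases h : ∃ z ∈ V, γ • (z : OnePoint K) = OnePoint.infty
  · obtain ⟨z, hz, hzi⟩ := h
    rw [tileMass, weight_rpow_eq_zero hz hzi hs, zero_mul]
    exact ENNReal.zero_lt_top
  · refine ENNReal.mul_lt_top ((weight_rpow_le_one γ V hs).trans_lt ENNReal.one_lt_top) ?_
    exact measure_preimage_coe_lt_top μ (isCompact_translate γ hV).isClosed h

/-- The tile of `∞` is an open neighbourhood of `∞`, so everything outside it has compact trace on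
`K`. The other tiles are disjoint and lie there, and their weights are at most one. The exceptional
tile has finitely many pieces, each of finite weighted mass. -/
theorem weightedMeasure_univ_lt_top_of_infty_mem [Finite ι] (hF : IsFundDomain Γ F)
    (hU : IsVerticialCovering F U) {s : ℝ} (hs : 0 < s) (hinf : OnePoint.infty ∈ regularSet Γ) :
    weightedMeasure μ Γ U s Set.univ < ∞ := by
  classical
  have := Fintype.ofFinite ι
  set γ₀ := tileElt hF ⟨OnePoint.infty, hinf⟩ with hγ₀
  have hinfmem : OnePoint.infty ∈ translate (γ₀ : PGL2 K) F :=
    ⟨_, tileRep_mem hF ⟨OnePoint.infty, hinf⟩, tileElt_smul_tileRep hF ⟨OnePoint.infty, hinf⟩⟩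
  set C : Set (OnePoint K) := (translate (γ₀ : PGL2 K) F)ᶜ with hC
  have hmT : ∀ (γ : PGL2 K) (i : ι), MeasurableSet (translate γ (U i)) := fun γ i =>
    (isOpen_translate γ (hU.isOpen i)).measurableSet
  have hmR := (isOpen_regularSet Γ).measurableSet
  -- The exceptional tile is replaced by the empty set, so that one disjoint union can be bounded by
  -- `C`.
  let T : Γ × ι → Set (OnePoint K) := fun q =>
    if q.1 = γ₀ then ∅ else regularSet Γ ∩ translate (q.1 : PGL2 K) (U q.2)
  have hTm : ∀ q, MeasurableSet (T q) := by
    intro q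
    dsimp only [T]
    split_ifs
    · exact MeasurableSet.empty
    · exact hmR.inter (hmT _ _)
  have hTmem : ∀ {q x}, x ∈ T q → q.1 ≠ γ₀ ∧ ∃ hx : x ∈ regularSet Γ, q.1 = tileElt hF ⟨x, hx⟩ ∧
      tileRep hF ⟨x, hx⟩ ∈ U q.2 := by
    intro q x hx
    dsimp only [T] at hx
    split_ifs at hx with hq
    · exact absurd hx (Set.notMem_empty x)
    · obtain ⟨hxR, z, hz, hzx⟩ := hx
      have hzF := hU.subset _ hz
      refine ⟨hq, hxR, (tileElt_eq hF hzF hzx).symm, ?_⟩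
      rwa [tileRep_eq hF (x := ⟨x, hxR⟩) hzF hzx]
  have hdisj : Pairwise (Function.onFun Disjoint T) := by
    intro q q' hqq
    refine Set.disjoint_left.2 fun x hx hx' => hqq ?_
    obtain ⟨-, hxR, h1, h2⟩ := hTmem hx
    obtain ⟨-, hxR', h1', h2'⟩ := hTmem hx'
    exact Prod.ext (h1.trans h1'.symm) (hU.eq_of_mem h2 h2')
  have hsub : (⋃ q, T q) ⊆ C := by
    refine Set.iUnion_subset fun q x hx => ?_
    obtain ⟨hq, hxR, h1, -⟩ := hTmem hx
    rintro ⟨z, hz, hzx⟩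
    exact hq (h1.trans (tileElt_eq hF (x := ⟨x, hxR⟩) hz hzx))
  have hsum : ∑' q, μ.map ((↑) : K → OnePoint K) (T q) < ∞ := by
    refine (tsum_meas_le_meas_iUnion_of_disjoint _ hTm hdisj).trans_lt
      ((measure_mono hsub).trans_lt ?_)
    have hCc : IsClosed C := (isOpen_translate _ hF.isOpen).isClosed_compl
    rw [Measure.map_apply measurable_coe_onePoint hCc.measurableSet]
    exact measure_preimage_coe_lt_top μ hCc fun h => h hinfmem
  have hsum' : ∑' q : Γ × ι, (if q.1 = γ₀ then tileMass μ s (γ₀ : PGL2 K) (U q.2) else 0) < ∞ := by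
    rw [ENNReal.tsum_prod', ENNReal.tsum_comm]
    simp only [tsum_ite_eq, tsum_fintype]
    exact ENNReal.sum_lt_top.2 fun i _ => tileMass_lt_top μ (hU.isCompact hF.isCompact i) hs
  rw [weightedMeasure_univ]
  refine lt_of_le_of_lt ?_ (ENNReal.add_lt_top.2 ⟨hsum', hsum⟩)
  rw [← ENNReal.tsum_add]
  refine ENNReal.tsum_le_tsum fun q => ?_
  by_cases hq : q.1 = γ₀
  · rw [if_pos hq]
    refine le_trans ?_ le_self_add
    rw [tileMass, ← Measure.map_apply measurable_coe_onePoint (hmT _ _), hq]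
    exact mul_le_mul_right (measure_mono Set.inter_subset_right) _
  · have hT : T q = regularSet Γ ∩ translate (q.1 : PGL2 K) (U q.2) := if_neg hq
    rw [if_neg hq, zero_add, hT]
    exact mul_le_of_le_one_left zero_le (weight_rpow_le_one _ _ hs)

end FiniteMeasure

/-! ### Affine maps and hyperbolic elements fixing `∞`. -/

section Affine

variable {K : Type u} [NontriviallyNormedField K]

/-- The matrix of the affine map `z ↦ a z + b`. -/
noncomputable def affineGL (a : Kˣ) (b : K) : Matrix.GeneralLinearGroup (Fin 2) K :=
  Matrix.GeneralLinearGroup.mkOfDetNeZero !![(a : K), b; 0, 1] (by simp [Matrix.det_fin_two])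

theorem affineGL_val (a : Kˣ) (b : K) : (affineGL a b).val = !![(a : K), b; 0, 1] := rfl

theorem affineGL_mul (a a' : Kˣ) (b b' : K) :
    affineGL a b * affineGL a' b' = affineGL (a * a') (a * b' + b) := by
  refine Units.ext ?_
  rw [Units.val_mul, affineGL_val, affineGL_val, affineGL_val]
  ext i j
  fin_cases i <;> fin_cases j <;> simp [Matrix.mul_apply, Fin.sum_univ_two]

theorem affineGL_one : affineGL (1 : Kˣ) (0 : K) = 1 := by
  refine Units.ext ?_
  rw [affineGL_val]
  ext i j
  fin_cases i <;> fin_cases j <;> simp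

/-- `γ` is an affine map with linear part `a`. -/
def IsAffine (γ : PGL2 K) (a : Kˣ) : Prop :=
  ∃ b : K, γ = Matrix.ProjGenLinGroup.mk (affineGL a b)

theorem IsAffine.mul {γ γ' : PGL2 K} {a a' : Kˣ} (h : IsAffine γ a) (h' : IsAffine γ' a') :
    IsAffine (γ * γ') (a * a') := by
  obtain ⟨b, rfl⟩ := h
  obtain ⟨b', rfl⟩ := h'
  exact ⟨_, by rw [← map_mul, affineGL_mul]⟩

theorem isAffine_one : IsAffine (1 : PGL2 K) 1 := ⟨0, by rw [affineGL_one, map_one]⟩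

theorem IsAffine.inv {γ : PGL2 K} {a : Kˣ} (h : IsAffine γ a) : IsAffine γ⁻¹ a⁻¹ := by
  obtain ⟨b, rfl⟩ := h
  refine ⟨-((a⁻¹ : Kˣ) * b), ?_⟩
  rw [inv_eq_iff_mul_eq_one, ← map_mul, affineGL_mul]
  simp [affineGL_one]

theorem IsAffine.zpow {γ : PGL2 K} {a : Kˣ} (h : IsAffine γ a) (n : ℤ) :
    IsAffine (γ ^ n) (a ^ n) := by
  have hnat : ∀ n : ℕ, IsAffine (γ ^ n) (a ^ n) := by
    intro n
    induction n with
    | zero => simpa using isAffine_one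
    | succ n ih => rw [pow_succ, pow_succ]; exact ih.mul h
  cases n with
  | ofNat n => simpa using hnat n
  | negSucc n => simpa using (hnat (n + 1)).inv

theorem IsAffine.smul_coe {γ : PGL2 K} {a : Kˣ} (h : IsAffine γ a) :
    ∃ b : K, ∀ z : K, γ • (z : OnePoint K) = ((a * z + b : K) : OnePoint K) := by
  obtain ⟨b, rfl⟩ := h
  refine ⟨b, fun z => ?_⟩
  have h00 : affineGL a b 0 0 = a := rfl
  have h01 : affineGL a b 0 1 = b := rfl
  have h10 : affineGL a b 1 0 = 0 := rfl
  have h11 : affineGL a b 1 1 = 1 := rfl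
  rw [mk_smul_coe, h00, h01, h10, h11]
  simp

theorem IsAffine.weight_eq {γ : PGL2 K} {a : Kˣ} (h : IsAffine γ a) {V : Set K}
    (hV : V.Nonempty) : weight γ V = max 1 ‖(a : K)‖ₑ := by
  obtain ⟨b, rfl⟩ := h
  have hd : ∀ z : K, derivAbs (Matrix.ProjGenLinGroup.mk (affineGL a b)) z = ‖(a : K)‖ₑ := by
    intro z
    rw [derivAbs_mk, glDerivAbs, affineGL_val]
    simp [Matrix.det_fin_two]
  rw [weight]
  simp only [hd]
  rw [biSup_const hV]

/-- Fixing `∞` makes the matrix upper triangular, with diagonal `a, d`. If `|a| = |d|`, the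
ultrametric inequality gives `|a + d|² ≤ |ad|`, against hyperbolicity; so the multiplier `a / d`
does not have absolute value one. -/
theorem exists_isAffine_of_smul_infty {γ : PGL2 K} (hγ : IsHyperbolic γ) [IsUltrametricDist K]
    (h : γ • (OnePoint.infty : OnePoint K) = OnePoint.infty) :
    ∃ a : Kˣ, ‖(a : K)‖ ≠ 1 ∧ IsAffine γ a := by
  obtain ⟨A, rfl, hA⟩ := hγ
  have hc : A.val 1 0 = 0 := by
    by_contra hne
    rw [mk_smul_infty, if_neg hne] at h
    exact OnePoint.coe_ne_infty _ h
  have hdet := A.det_ne_zero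
  rw [Matrix.det_fin_two, hc, mul_zero, sub_zero] at hdet
  rw [Matrix.det_fin_two, Matrix.trace_fin_two, hc, mul_zero, sub_zero, norm_mul] at hA
  have ha := left_ne_zero_of_mul hdet
  have hd := right_ne_zero_of_mul hdet
  refine ⟨Units.mk0 (A.val 0 0 / A.val 1 1) (div_ne_zero ha hd), ?_, A.val 0 1 / A.val 1 1, ?_⟩
  · rw [Units.val_mk0, norm_div]
    intro h1
    rw [div_eq_one_iff_eq (norm_ne_zero_iff.2 hd)] at h1
    have h2 := IsUltrametricDist.norm_add_le_max (A.val 0 0) (A.val 1 1)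
    rw [h1, max_self] at h2
    rw [h1, ← sq] at hA
    exact absurd hA (not_lt.2 (pow_le_pow_left₀ (norm_nonneg _) h2 2))
  · symm
    refine Matrix.ProjGenLinGroup.mk_eq_mk_iff.2 ⟨Units.mk0 (A.val 1 1) hd, Units.ext ?_⟩
    rw [Units.val_mul, affineGL_val]
    ext i j
    fin_cases i <;> fin_cases j <;>
      simp [Matrix.mul_apply, Matrix.diagonal_apply, hc, hd]

theorem exists_zpow_eq {G : Type*} [Group G] (b : FreeGroupBasis (Fin 1) G) (γ : G) :
    ∃ n : ℤ, b 0 ^ n = γ := by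
  refine ⟨FreeGroup.equivIntOfUnique (b.repr γ), b.repr.injective ?_⟩
  rw [map_zpow, b.repr_apply_coe]
  exact FreeGroup.equivIntOfUnique.left_inv (b.repr γ)

end Affine

/-! ### Finiteness of the weighted measure in rank one with `∞` fixed. -/

section RankOne

variable {K : Type u} [NontriviallyNormedField K] [ProperSpace K]
variable [MeasurableSpace K] [BorelSpace K]
variable (μ : Measure K) [μ.IsAddHaarMeasure]

open scoped Pointwise in
theorem IsAffine.measure_translate {γ : PGL2 K} {a : Kˣ} (h : IsAffine γ a) (V : Set K) :
    μ (((↑) : K → OnePoint K) ⁻¹' translate γ V) = distribHaarChar K a * μ V := by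
  obtain ⟨b, hb⟩ := h.smul_coe
  have h1 : ((↑) : K → OnePoint K) ⁻¹' translate γ V = (fun z => z + -b) ⁻¹' (a • V) := by
    ext z
    simp only [translate, hb, Set.mem_preimage, Set.mem_image, OnePoint.coe_eq_coe,
      Set.mem_smul_set, Units.smul_def, smul_eq_mul, eq_add_neg_iff_add_eq]
  rw [h1, measure_preimage_add_right, distribHaarChar_mul]

open scoped Pointwise in
theorem distribHaarChar_eq_measure_closedBall (hμ : μ (Metric.closedBall 0 1) = 1) (a : Kˣ) :
    (distribHaarChar K a : ℝ≥0∞) = μ (Metric.closedBall 0 ‖(a : K)‖) := by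
  have h : Metric.closedBall (0 : K) ‖(a : K)‖ = a • Metric.closedBall (0 : K) 1 := by
    ext z
    rw [Set.mem_smul_set_iff_inv_smul_mem, mem_closedBall_zero_iff, mem_closedBall_zero_iff,
      Units.smul_def, smul_eq_mul, norm_mul, Units.val_inv_eq_inv_val, norm_inv,
      inv_mul_le_one₀ (norm_pos_iff.2 a.ne_zero)]
  rw [h, ← distribHaarChar_mul, hμ, mul_one]

/-- The open unit ball around `1` lies in the closed unit ball, misses the smaller ball, and has
positive measure. -/
theorem measure_closedBall_lt_one [IsUltrametricDist K] (hμ : μ (Metric.closedBall 0 1) = 1)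
    {r : ℝ} (hr1 : r < 1) : μ (Metric.closedBall 0 r) < 1 := by
  have hdisj : Disjoint (Metric.closedBall (0 : K) r) (Metric.ball 1 1) := by
    rw [Set.disjoint_left]
    intro z hz hz1
    rw [mem_closedBall_zero_iff] at hz
    rw [mem_ball_iff_norm'] at hz1
    have h := IsUltrametricDist.norm_add_le_max (1 - z) z
    rw [sub_add_cancel, norm_one] at h
    exact absurd h (not_le.2 (max_lt hz1 (hz.trans_lt hr1)))
  have hsub : Metric.closedBall (0 : K) r ∪ Metric.ball 1 1 ⊆ Metric.closedBall 0 1 := by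
    refine Set.union_subset (Metric.closedBall_subset_closedBall hr1.le) fun z hz => ?_
    rw [mem_ball_iff_norm] at hz
    rw [mem_closedBall_zero_iff]
    have h := IsUltrametricDist.norm_add_le_max (z - 1) 1
    rw [sub_add_cancel, norm_one] at h
    exact h.trans (max_le hz.le le_rfl)
  have h1 : μ (Metric.closedBall 0 r) + μ (Metric.ball 1 1) ≤ 1 := by
    rw [← measure_union hdisj Metric.isOpen_ball.measurableSet, ← hμ]
    exact measure_mono hsub
  have h2 : 0 < μ (Metric.ball (1 : K) 1) := Metric.measure_ball_pos μ 1 one_pos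
  have h3 : μ (Metric.closedBall (0 : K) r) ≠ ∞ :=
    (isCompact_closedBall (0 : K) r).measure_lt_top.ne
  exact (ENNReal.lt_add_right h3 h2.ne').trans_le h1

variable [IsUltrametricDist K] {Γ : Subgroup (PGL2 K)} {F : Set K} {ι : Type*} {U : ι → Set K}

/-- Let `χ` be the factor by which `a` scales Haar measure. Positive powers of `γ` shrink `V`, with
ratio `χ < 1`. Negative powers enlarge it by `χ⁻¹` but carry a weight factor `|a|^s` at each step;
the ratio `|a|^s χ⁻¹` is below one exactly by the assumption on `s`. -/
theorem tsum_tileMass_lt_top {V : Set K} (hVc : IsCompact V) (hV : V.Nonempty)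
    (hμ : μ (Metric.closedBall 0 1) = 1) {s : ℝ} (hs : 0 < s) {γ : PGL2 K} {a : Kˣ}
    (h : IsAffine γ a) (ha : ‖(a : K)‖ < 1)
    (has : ENNReal.ofReal (‖(a : K)‖ ^ s) < μ (Metric.closedBall 0 ‖(a : K)‖)) :
    ∑' n : ℤ, tileMass μ s (γ ^ n) V < ∞ := by
  set χ : ℝ≥0∞ := ((distribHaarChar K a : ℝ≥0) : ℝ≥0∞) with hχ
  rw [← distribHaarChar_eq_measure_closedBall μ hμ, ← hχ] at has
  have hχ1 : χ < 1 := by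
    rw [hχ, distribHaarChar_eq_measure_closedBall μ hμ]
    exact measure_closedBall_lt_one μ hμ ha
  have hVt : μ V ≠ ∞ := hVc.measure_lt_top.ne
  have hpos : ∀ n : ℕ, tileMass μ s (γ ^ (n : ℤ)) V ≤ χ ^ n * μ V := by
    intro n
    rw [tileMass, (h.zpow n).measure_translate μ V]
    refine (mul_le_of_le_one_left zero_le (weight_rpow_le_one _ _ hs)).trans_eq ?_
    rw [zpow_natCast, map_pow, ENNReal.coe_pow]
  have hneg : ∀ n : ℕ, tileMass μ s (γ ^ (-(n + 1) : ℤ)) V ≤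
      (ENNReal.ofReal (‖(a : K)‖ ^ s) * χ⁻¹) ^ (n + 1) * μ V := by
    intro n
    have hza : (a ^ (-(n + 1) : ℤ)) = (a ^ (n + 1))⁻¹ := by
      rw [zpow_neg]
      norm_cast
    have hchar : (distribHaarChar K (a ^ (-(n + 1) : ℤ)) : ℝ≥0∞) = χ⁻¹ ^ (n + 1) := by
      rw [hza, map_inv, map_pow, ENNReal.coe_inv (pow_ne_zero _ distribHaarChar_pos.ne'),
        ENNReal.coe_pow, ENNReal.inv_pow]
    rw [tileMass, (h.zpow _).measure_translate μ V, (h.zpow _).weight_eq hV, hchar, mul_pow,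
      mul_assoc]
    refine mul_le_mul_left ?_ _
    have hw : ‖((a ^ (-(n + 1) : ℤ) : Kˣ) : K)‖ₑ = (‖(a : K)‖ₑ ^ (n + 1))⁻¹ := by
      rw [hza, Units.val_inv_eq_inv_val, enorm_inv (Units.ne_zero _), Units.val_pow_eq_pow_val,
        enorm_pow]
    have hsa : ENNReal.ofReal (‖(a : K)‖ ^ s) = ‖(a : K)‖ₑ ^ s := by
      rw [← ENNReal.ofReal_rpow_of_nonneg (norm_nonneg _) hs.le, ofReal_norm]
    have hpow : (‖(a : K)‖ₑ ^ s) ^ (n + 1) = (‖(a : K)‖ₑ ^ (n + 1)) ^ s := by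
      rw [← ENNReal.rpow_natCast (‖(a : K)‖ₑ ^ s), ← ENNReal.rpow_mul, mul_comm, ENNReal.rpow_mul,
        ENNReal.rpow_natCast]
    rw [hw, hsa, hpow, ENNReal.rpow_neg, ← ENNReal.inv_rpow]
    refine ENNReal.rpow_le_rpow ?_ hs.le
    rw [ENNReal.inv_le_iff_inv_le]
    exact le_max_right _ _
  rw [tsum_of_nat_of_neg_add_one ENNReal.summable ENNReal.summable]
  refine ENNReal.add_lt_top.2 ⟨?_, ?_⟩
  · refine (ENNReal.tsum_le_tsum hpos).trans_lt ?_
    rw [ENNReal.tsum_mul_right, ENNReal.tsum_geometric]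
    refine ENNReal.mul_lt_top (ENNReal.inv_lt_top.2 ?_) hVt.lt_top
    exact tsub_pos_of_lt hχ1
  · refine (ENNReal.tsum_le_tsum hneg).trans_lt ?_
    have hr1 : ENNReal.ofReal (‖(a : K)‖ ^ s) * χ⁻¹ < 1 := by
      rw [← div_eq_mul_inv]
      exact ENNReal.div_lt_of_lt_mul (by rwa [one_mul])
    simp only [pow_succ, mul_assoc]
    rw [ENNReal.tsum_mul_right, ENNReal.tsum_geometric]
    refine ENNReal.mul_lt_top (ENNReal.inv_lt_top.2 (tsub_pos_of_lt hr1)) ?_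
    rw [← mul_assoc]
    exact ENNReal.mul_lt_top (hr1.trans ENNReal.one_lt_top) hVt.lt_top

theorem weightedMeasure_univ_lt_top_of_rank_one [Finite ι] (hΓ : IsSchottky Γ 1)
    (hF : IsFundDomain Γ F) (hU : IsVerticialCovering F U)
    (hμ : μ (Metric.closedBall 0 1) = 1) {s : ℝ} (hs : 0 < s)
    (hfix : ∀ γ ∈ Γ, γ • (OnePoint.infty : OnePoint K) = OnePoint.infty)
    (has : ∀ a : K, a ≠ 0 → ‖a‖ < 1 →
      ENNReal.ofReal (‖a‖ ^ s) < μ (Metric.closedBall 0 ‖a‖)) :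
    weightedMeasure μ Γ U s Set.univ < ∞ := by
  have := Fintype.ofFinite ι
  obtain ⟨b, hb⟩ := hΓ.free
  -- If the given generator expands, its inverse is a contracting generator.
  obtain ⟨γ, a, ha, hγ, hgen⟩ : ∃ (γ : Γ) (a : Kˣ), ‖(a : K)‖ < 1 ∧ IsAffine (γ : PGL2 K) a ∧
      Function.Surjective fun n : ℤ => γ ^ n := by
    obtain ⟨a, ha, hγ⟩ := exists_isAffine_of_smul_infty (hb 0) (hfix _ (b 0).2)
    rcases lt_or_gt_of_ne ha with ha | ha
    · exact ⟨b 0, a, ha, hγ, exists_zpow_eq b⟩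
    · refine ⟨(b 0)⁻¹, a⁻¹, ?_, hγ.inv, fun δ => ?_⟩
      · rw [Units.val_inv_eq_inv_val, norm_inv]
        exact inv_lt_one_of_one_lt₀ ha
      · obtain ⟨n, hn⟩ := exists_zpow_eq b δ
        exact ⟨-n, by simpa using hn⟩
  refine (weightedMeasure_univ_le μ Γ s fun γ i =>
    (isOpen_translate γ (hU.isOpen i)).measurableSet).trans_lt ?_
  rw [ENNReal.tsum_prod', ENNReal.tsum_comm, tsum_fintype]
  refine ENNReal.sum_lt_top.2 fun i _ => ?_
  refine (ENNReal.tsum_le_tsum_comp_of_surjective hgen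
    fun δ : Γ => tileMass μ s (δ : PGL2 K) (U i)).trans_lt ?_
  simp only [Subgroup.coe_zpow]
  exact tsum_tileMass_lt_top μ (hU.isCompact hF.isCompact i) (hU.nonempty i) hμ hs hγ ha
    (has a a.ne_zero ha)

end RankOne

/-! ### Boundedness of the heat operator. -/

theorem integrable_mul_of_abs_le {X : Type*} [MeasurableSpace X] {N : Measure X}
    [IsFiniteMeasure N] {k f : X → ℝ} (hk : Measurable k) (hf : Measurable f) {M C : ℝ}
    (hM : ∀ y, |k y| ≤ M) (hC : ∀ y, |f y| ≤ C) : Integrable (fun y => k y * f y) N := by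
  refine Integrable.of_bound (hk.mul hf).aestronglyMeasurable (M * C) (ae_of_all _ fun y => ?_)
  rw [Real.norm_eq_abs, abs_mul]
  exact mul_le_mul (hM y) (hC y) (abs_nonneg _) ((abs_nonneg _).trans (hM y))

theorem continuousOn_integral_mul_of_abs_le {X Z : Type*} [MeasurableSpace X]
    [TopologicalSpace Z] [FirstCountableTopology Z] {N : Measure X} [IsFiniteMeasure N]
    {k : Z → X → ℝ} {f : X → ℝ} {S : Set Z} (hk : ∀ u, Measurable (k u))
    (hkc : ∀ y, ContinuousOn (fun u => k u y) S) (hf : Measurable f) {M C : ℝ}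
    (hM : ∀ u ∈ S, ∀ y, |k u y| ≤ M) (hC : ∀ y, |f y| ≤ C) :
    ContinuousOn (fun u => ∫ y, k u y * f y ∂N) S := by
  refine continuousOn_of_dominated (bound := fun _ => M * C) (fun u _ => ?_) (fun u hu => ?_)
    (integrable_const _) (ae_of_all _ fun y => (hkc y).mul continuousOn_const)
  · exact ((hk u).mul hf).aestronglyMeasurable
  · refine ae_of_all _ fun y => ?_
    rw [Real.norm_eq_abs, abs_mul]
    exact mul_le_mul (hM u hu y) (hC y) (abs_nonneg _) ((abs_nonneg _).trans (hM u hu y))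

section HeatOperator

variable {K : Type u} [NontriviallyNormedField K] [IsUltrametricDist K] [ProperSpace K]
variable [MeasurableSpace K] [BorelSpace K] {μ : Measure K} {Γ : Subgroup (PGL2 K)} {F : Set K}
variable {ι : Type*} [Fintype ι] {U : ι → Set K} {A : Matrix ι ι ℝ} {α s : ℝ}
variable (hF : IsFundDomain Γ F) (hU : IsVerticialCovering F U) (hA_diag : ∀ i, A i i = 0)

include hF hU

theorem measurable_invKernel :
    Measurable fun q : regularSet Γ × regularSet Γ => invKernel Γ U A α q.1 q.2 := by
  have h := (measurable_baseKernel (A := A) (α := α) hU).comp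
    (((continuous_tileRep hF).measurable.comp measurable_fst).prodMk
      ((continuous_tileRep hF).measurable.comp measurable_snd))
  have h2 : (fun q : regularSet Γ × regularSet Γ => invKernel Γ U A α q.1 q.2) = fun q =>
      baseKernel U A α ((tileRep hF q.1 : K) : OnePoint K) ((tileRep hF q.2 : K) : OnePoint K) :=
    funext fun q => invKernel_eq hF hU q.1 q.2
  rw [h2]
  exact h

omit [ProperSpace K] [MeasurableSpace K] [BorelSpace K] in
include hA_diag in
theorem exists_bound_invKernel :
    ∃ M : ℝ, 0 ≤ M ∧ ∀ x y : regularSet Γ, |invKernel Γ U A α x y| ≤ M := by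
  obtain ⟨M, hM⟩ := exists_bound_baseKernel (α := α) hF hU hA_diag
  refine ⟨|M|, abs_nonneg M, fun x y => ?_⟩
  rw [invKernel_eq hF hU]
  exact (hM _ (tileRep_mem hF x) _ (tileRep_mem hF y)).trans (le_abs_self M)

variable [IsFiniteMeasure (weightedMeasure μ Γ U s)]

include hA_diag in
theorem integrable_invKernel_mul {f : regularSet Γ → ℝ} (hf : Measurable f) {C : ℝ}
    (hC : ∀ y, |f y| ≤ C) (x : regularSet Γ) :
    Integrable (fun y : regularSet Γ => invKernel Γ U A α x y * f y)
      (weightedMeasure μ Γ U s) := by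
  obtain ⟨M, -, hM⟩ := exists_bound_invKernel (α := α) hF hU hA_diag
  exact integrable_mul_of_abs_le (Measurable.of_uncurry_left
    (f := fun x y : regularSet Γ => invKernel Γ U A α x y) (measurable_invKernel hF hU)) hf
    (hM x) hC

omit hF hU [IsUltrametricDist K] [ProperSpace K] [MeasurableSpace K] [BorelSpace K]
  [IsFiniteMeasure (weightedMeasure μ Γ U s)] in
theorem abs_sub_le_two_mul_norm (f : regularSet Γ →ᵇ ℝ) (x y : regularSet Γ) :
    |f y - f x| ≤ 2 * ‖f‖ := f.dist_le_two_norm y x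

include hA_diag in
-- Dominated convergence gives continuity in a variable `u` on `F`; composing with the continuous
-- `tileRep` transfers it to the regular set.
theorem continuous_integral_invKernel_mul {f : regularSet Γ → ℝ} (hf : Measurable f) {C : ℝ}
    (hC : ∀ y, |f y| ≤ C) :
    Continuous fun x : regularSet Γ =>
      ∫ y : regularSet Γ, invKernel Γ U A α x y * f y ∂weightedMeasure μ Γ U s := by
  obtain ⟨M, hM⟩ := exists_bound_baseKernel (α := α) hF hU hA_diag
  have hG : ContinuousOn (fun u : K => ∫ y : regularSet Γ,
      baseKernel U A α (u : OnePoint K) ((tileRep hF y : K) : OnePoint K) * f y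
        ∂weightedMeasure μ Γ U s) F := by
    have hm : ∀ u : K, Measurable fun v : K => baseKernel U A α (u : OnePoint K) v := fun u =>
      Measurable.of_uncurry_left
        (f := fun u v : K => baseKernel U A α (u : OnePoint K) v) (measurable_baseKernel hU)
    refine continuousOn_integral_mul_of_abs_le
      (k := fun (u : K) (y : regularSet Γ) =>
        baseKernel U A α (u : OnePoint K) ((tileRep hF y : K) : OnePoint K))
      (fun u => (hm u).comp (continuous_tileRep hF).measurable) (fun y => ?_) hf
      (fun u hu y => hM u hu _ (tileRep_mem hF y)) hC
    have hc := ContinuousOn.comp (g := fun q : K × K => baseKernel U A α (q.1 : OnePoint K) q.2)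
      (f := fun u : K => (u, tileRep hF y)) (s := F) (continuousOn_baseKernel hU hA_diag)
      (by fun_prop) fun u hu => ⟨hu, tileRep_mem hF y⟩
    exact hc
  refine (hG.comp_continuous (continuous_tileRep hF) (tileRep_mem hF)).congr fun x => ?_
  simp only [invKernel_eq hF hU, Function.comp_apply]

include hA_diag in
theorem exists_heatOperator_linearMap :
    ∃ (D : invFunctions Γ →ₗ[ℝ] invFunctions Γ) (C : ℝ), (∀ f, ‖D f‖ ≤ C * ‖f‖) ∧
      ∀ f x, (D f).1 x = heatOperator μ Γ U A α s f.1 x := by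
  obtain ⟨M, hM0, hM⟩ := exists_bound_invKernel (α := α) hF hU hA_diag
  have hint : ∀ (f : regularSet Γ →ᵇ ℝ) (x : regularSet Γ),
      Integrable (fun y : regularSet Γ => invKernel Γ U A α x y * (f y - f x))
        (weightedMeasure μ Γ U s) := fun f x =>
    integrable_invKernel_mul hF hU hA_diag (f.continuous.measurable.sub_const _)
      (fun y => abs_sub_le_two_mul_norm f x y) x
  have hbound : ∀ (f : regularSet Γ →ᵇ ℝ) (x : regularSet Γ), ‖heatOperator μ Γ U A α s f x‖ ≤
      2 * M * (weightedMeasure μ Γ U s).real Set.univ * ‖f‖ := by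
    intro f x
    refine (norm_integral_le_of_norm_le_const (C := M * (2 * ‖f‖))
      (ae_of_all _ fun y => ?_)).trans_eq (by ring)
    rw [Real.norm_eq_abs, abs_mul]
    exact mul_le_mul (hM x y) (abs_sub_le_two_mul_norm f x y) (abs_nonneg _) hM0
  have hcont : ∀ f : regularSet Γ →ᵇ ℝ, Continuous (heatOperator μ Γ U A α s f) := by
    intro f
    -- The integral is split as `∫ k f - f(x) ∫ k`, so that the integrated function no longer
    -- depends on `x`.
    have h1 := continuous_integral_invKernel_mul (μ := μ) (α := α) (s := s) hF hU hA_diag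
      f.continuous.measurable (fun y => f.norm_coe_le_norm y)
    have h2 := continuous_integral_invKernel_mul (μ := μ) (α := α) (s := s) hF hU hA_diag
      (measurable_const (a := (1 : ℝ))) (C := 1) (fun y => by simp)
    refine (h1.sub (h2.mul f.continuous)).congr fun x => ?_
    simp only [Pi.sub_apply, Pi.mul_apply]
    rw [← integral_mul_const, ← integral_sub]
    · refine integral_congr_ae (ae_of_all _ fun y => ?_)
      ring
    · exact integrable_invKernel_mul hF hU hA_diag f.continuous.measurable
        (fun y => f.norm_coe_le_norm y) x
    · exact (integrable_invKernel_mul hF hU hA_diag (measurable_const (a := (1 : ℝ))) (C := 1)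
        (fun y => by simp) x).mul_const _
  let D₀ : (regularSet Γ →ᵇ ℝ) → (regularSet Γ →ᵇ ℝ) := fun f =>
    BoundedContinuousFunction.ofNormedAddCommGroup (heatOperator μ Γ U A α s f) (hcont f) _
      (hbound f)
  -- The point `x` enters only through `f x` and its representative, both unchanged under `Γ`.
  have hD₀ : ∀ f ∈ invFunctions Γ, D₀ f ∈ invFunctions Γ := by
    intro f hf γ hγ x y hxy
    change heatOperator μ Γ U A α s f y = heatOperator μ Γ U A α s f x
    simp only [heatOperator, invKernel_eq hF hU, hf γ hγ x y hxy,
      tileRep_eq_of_smul_eq hF hγ hxy]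
  let D₁ : invFunctions Γ →ₗ[ℝ] invFunctions Γ :=
    { toFun := fun f => ⟨D₀ f.1, hD₀ f.1 f.2⟩
      map_add' := by
        intro f g
        refine Subtype.ext (BoundedContinuousFunction.ext fun x => ?_)
        change heatOperator μ Γ U A α s (f.1 + g.1 : regularSet Γ →ᵇ ℝ) x =
          heatOperator μ Γ U A α s f.1 x + heatOperator μ Γ U A α s g.1 x
        rw [heatOperator, heatOperator, heatOperator, ← integral_add (hint f.1 x) (hint g.1 x)]
        refine integral_congr_ae (ae_of_all _ fun y => ?_)
        simp only [BoundedContinuousFunction.coe_add, Pi.add_apply]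
        ring
      map_smul' := by
        intro r f
        refine Subtype.ext (BoundedContinuousFunction.ext fun x => ?_)
        change heatOperator μ Γ U A α s (r • f.1 : regularSet Γ →ᵇ ℝ) x =
          r * heatOperator μ Γ U A α s f.1 x
        rw [heatOperator, heatOperator, ← integral_const_mul]
        refine integral_congr_ae (ae_of_all _ fun y => ?_)
        simp only [BoundedContinuousFunction.coe_smul, smul_eq_mul]
        ring }
  refine ⟨D₁, 2 * M * (weightedMeasure μ Γ U s).real Set.univ, fun f => ?_, fun f x => rfl⟩
  exact BoundedContinuousFunction.norm_ofNormedAddCommGroup_le _ (by positivity) (hbound f.1)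

end HeatOperator

/-! ### The Cauchy problem for a bounded generator. -/

section Cauchy

/-- Uniformization of the exponential of a bounded generator. -/
theorem hasSum_poissonWeight_smul_pow {𝔸 : Type*} [NormedRing 𝔸] [NormedAlgebra ℝ 𝔸]
    [CompleteSpace 𝔸] (c t : ℝ) (T : 𝔸) :
    HasSum (fun n => poissonWeight c n t • T ^ n) (NormedSpace.exp (t • c • (T - 1))) := by
  let : NormedAlgebra ℚ 𝔸 := NormedAlgebra.restrictScalars ℚ ℝ 𝔸
  have h1 : t • c • (T - 1) = (c * t) • T + algebraMap ℝ 𝔸 (-(c * t)) := by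
    rw [Algebra.algebraMap_eq_smul_one, smul_sub, smul_sub, smul_smul, smul_smul, mul_comm t c,
      neg_smul, sub_eq_add_neg]
  have h2 : Commute ((c * t) • T) (algebraMap ℝ 𝔸 (-(c * t))) := (Algebra.commutes _ _).symm
  rw [h1, NormedSpace.exp_add_of_commute h2, ← NormedSpace.algebraMap_exp_comm,
    ← Real.exp_eq_exp_ℝ, ← Algebra.commutes, ← Algebra.smul_def]
  refine (((NormedSpace.exp_series_hasSum_exp' (𝕂 := ℝ) ((c * t) • T))).const_smul
    (Real.exp (-(c * t)))).congr_fun fun n => ?_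
  rw [poissonWeight, smul_pow, smul_smul, smul_smul]
  congr 1
  ring

/-- The Cauchy problem for a bounded generator. -/
theorem exists_solution_of_bounded {E : Type*} [NormedAddCommGroup E] [NormedSpace ℝ E]
    [CompleteSpace E] (D : E →ₗ[ℝ] E) (C : ℝ) (hC : ∀ f, ‖D f‖ ≤ C * ‖f‖) (h₀ : E) :
    ∃ h : ℝ → E, DifferentiableOn ℝ h (Set.Ici 0) ∧ ContDiffOn ℝ 1 h (Set.Ioi 0) ∧
      (∀ t, 0 ≤ t → derivWithin h (Set.Ici 0) t = D (h t)) ∧ h 0 = h₀ ∧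
      (∀ c : ℝ, c ≠ 0 → ∀ t, HasSum
        (fun n => poissonWeight c n t • (fun f => f + c⁻¹ • D f)^[n] h₀) (h t)) ∧
      ∀ h' : ℝ → E, DifferentiableOn ℝ h' (Set.Ici 0) →
        (∀ t, 0 ≤ t → derivWithin h' (Set.Ici 0) t = D (h' t)) → h' 0 = h₀ →
        Set.EqOn h' h (Set.Ici 0) := by
  let L : E →L[ℝ] E := D.mkContinuous C hC
  have hd : ∀ t : ℝ, HasDerivAt (fun t : ℝ => NormedSpace.exp (t • L) h₀)
      (D (NormedSpace.exp (t • L) h₀)) t := by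
    intro t
    have h2 := (hasDerivAt_exp_smul_const' (𝕂 := ℝ) L t).clm_apply (hasDerivAt_const t h₀)
    have h3 : HasDerivAt (fun t : ℝ => NormedSpace.exp (t • L) h₀)
      (L (NormedSpace.exp (t • L) h₀)) t := by simpa using h2
    exact h3
  have hdiff : Differentiable ℝ fun t : ℝ => NormedSpace.exp (t • L) h₀ :=
    fun t => (hd t).differentiableAt
  have hdw : ∀ t : ℝ, 0 ≤ t → derivWithin (fun t : ℝ => NormedSpace.exp (t • L) h₀)
      (Set.Ici 0) t = D (NormedSpace.exp (t • L) h₀) := fun t ht =>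
    (hd t).hasDerivWithinAt.derivWithin (uniqueDiffOn_Ici 0 t ht)
  have h0 : NormedSpace.exp ((0 : ℝ) • L) h₀ = h₀ := by
    rw [zero_smul, NormedSpace.exp_zero]
    rfl
  refine ⟨fun t => NormedSpace.exp (t • L) h₀, hdiff.differentiableOn, ?_, hdw, h0, ?_, ?_⟩
  · refine ContDiff.contDiffOn (contDiff_one_iff_deriv.2 ⟨hdiff, ?_⟩)
    have : deriv (fun t : ℝ => NormedSpace.exp (t • L) h₀) =
        fun t => L (NormedSpace.exp (t • L) h₀) := funext fun t => (hd t).deriv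
    rw [this]
    exact L.continuous.comp hdiff.continuous
  · intro c hc t
    -- With `T = 1 + c⁻¹ L` one has `c (T - 1) = L`, whatever the nonzero `c`; the jump process will
    -- choose `c`.
    have h1 := hasSum_poissonWeight_smul_pow c t (1 + c⁻¹ • L)
    rw [add_sub_cancel_left, smul_inv_smul₀ hc] at h1
    refine (h1.mapL (ContinuousLinearMap.apply ℝ E h₀)).congr_fun fun n => ?_
    rw [ContinuousLinearMap.apply_apply, smul_apply]
    congr 1
    induction n with
    | zero => rfl
    | succ n ih =>
      rw [Function.iterate_succ_apply', ih, pow_succ']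
      rfl
  · intro h' hdiff' hder' h0' b hb
    -- Uniqueness by Grönwall needs only right derivatives, so the one-sided derivative at `0`
    -- causes no trouble.
    have key : ∀ {g : ℝ → E}, DifferentiableOn ℝ g (Set.Ici 0) →
        (∀ t, 0 ≤ t → derivWithin g (Set.Ici 0) t = D (g t)) → ∀ t : ℝ, 0 ≤ t →
        HasDerivWithinAt g (L (g t)) (Set.Ici t) t := by
      intro g hg hg' t ht
      have h1 : L (g t) = derivWithin g (Set.Ici 0) t := (hg' t ht).symm
      rw [h1]
      exact (hg t ht).hasDerivWithinAt.mono (Set.Ici_subset_Ici.2 ht)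
    refine ODE_solution_unique (v := fun _ => L) (K := ‖L‖₊) (a := 0) (b := b)
      (fun _ => L.lipschitz) ?_ (fun t ht => key hdiff' hder' t ht.1) ?_
      (fun t ht => key hdiff.differentiableOn hdw t ht.1) (h0'.trans h0.symm) ⟨hb, le_rfl⟩
    · exact hdiff'.continuousOn.mono Set.Icc_subset_Ici_self
    · exact hdiff.continuous.continuousOn

theorem completeSpace_invFunctions {K : Type u} [NontriviallyNormedField K]
    (Γ : Subgroup (PGL2 K)) : CompleteSpace (invFunctions Γ) := by
  have h : (invFunctions Γ : Set (regularSet Γ →ᵇ ℝ)) = ⋂ γ ∈ Γ, ⋂ x : regularSet Γ,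
      ⋂ y : regularSet Γ, ⋂ _ : γ • (x : OnePoint K) = y, {f | f y = f x} := by
    ext f
    simp only [Set.mem_iInter]
    rfl
  have hc : IsClosed (invFunctions Γ : Set (regularSet Γ →ᵇ ℝ)) := by
    rw [h]
    exact isClosed_biInter fun γ _ => isClosed_iInter fun x => isClosed_iInter fun y =>
      isClosed_iInter fun _ => isClosed_eq
        (BoundedContinuousFunction.evalCLM ℝ y).continuous
        (BoundedContinuousFunction.evalCLM ℝ x).continuous
  exact hc.isComplete.completeSpace_coe

end Cauchy

/-! ### Realizing a bounded generator by random updates. -/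

section JumpRealization

variable {S : Type u} [MeasurableSpace S] {N : Measure S} [IsFiniteMeasure N] {k : S → S → ℝ}

theorem exists_smul_probabilityMeasure [Nonempty S] (N : Measure S) [IsFiniteMeasure N] :
    ∃ ρ : Measure S, IsProbabilityMeasure ρ ∧ N = N Set.univ • ρ := by
  by_cases h : N = 0
  · exact ⟨Measure.dirac (Classical.arbitrary S), inferInstance, by simp [h]⟩
  · have : NeZero N := ⟨h⟩
    refine ⟨(N Set.univ)⁻¹ • N, inferInstance, ?_⟩
    rw [smul_smul, ENNReal.mul_inv_cancel (by simpa using h) (measure_ne_top _ _), one_smul]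

theorem integral_indicator_lt_Ico {b : ℝ} (h0 : 0 ≤ b) (h1 : b ≤ 1) :
    ∫ u, (Set.Iio b).indicator (fun _ => (1 : ℝ)) u ∂volume.restrict (Set.Ico (0 : ℝ) 1) = b := by
  rw [integral_indicator_const _ measurableSet_Iio, smul_eq_mul, mul_one, measureReal_def,
    Measure.restrict_apply measurableSet_Iio]
  have h : Set.Iio b ∩ Set.Ico (0 : ℝ) 1 = Set.Ico 0 b := by
    ext u
    simp only [Set.mem_inter_iff, Set.mem_Iio, Set.mem_Ico]
    constructor
    · rintro ⟨h2, h3, -⟩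
      exact ⟨h3, h2⟩
    · rintro ⟨h2, h3⟩
      exact ⟨h3, h2, h3.trans_le h1⟩
  rw [h, Real.volume_Ico, sub_zero, ENNReal.toReal_ofReal h0]

/-- A bounded generator `f ↦ ∫ k(x, y) (f(y) - f(x)) N(dy)` is realized by random updates. -/
theorem exists_update [Nonempty S] (hk : Measurable fun q : S × S => k q.1 q.2)
    (hk0 : ∀ x y, 0 ≤ k x y) {M : ℝ} (hkM : ∀ x y, k x y ≤ M) :
    ∃ (c : ℝ) (_ : 0 < c) (ρ : Measure (S × ℝ)) (_ : IsProbabilityMeasure ρ)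
      (φ : S × (S × ℝ) → S), Measurable φ ∧ ∀ (f : S → ℝ) (C : ℝ), Measurable f →
        (∀ y, |f y| ≤ C) → ∀ x,
          ∫ v, f (φ (x, v)) ∂ρ = f x + c⁻¹ * ∫ y, k x y * (f y - f x) ∂N := by
  classical
  obtain ⟨ρ₁, hρ₁, hN⟩ := exists_smul_probabilityMeasure N
  set B : ℝ := (N Set.univ).toReal with hB
  have hB0 : 0 ≤ B := ENNReal.toReal_nonneg
  have hM0 : 0 ≤ M := (hk0 (Classical.arbitrary S) (Classical.arbitrary S)).trans (hkM _ _)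
  -- `B * M` bounds every total jump rate; the summand `1` keeps the clock rate positive even if the
  -- measure or the kernel vanishes.
  have hc : 0 < B * M + 1 := by positivity
  set c : ℝ := B * M + 1 with hcdef
  have hunif : IsProbabilityMeasure (volume.restrict (Set.Ico (0 : ℝ) 1)) := ⟨by simp⟩
  have hset : MeasurableSet {q : S × (S × ℝ) | q.2.2 < B * k q.1 q.2.1 / c} := by
    refine measurableSet_lt (measurable_snd.comp measurable_snd) ?_
    exact ((hk.comp (measurable_fst.prodMk (measurable_fst.comp measurable_snd))).const_mul
      B).div_const c
  -- Rejection sampling: a candidate is drawn from the normalized measure and accepted with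
  -- probability `B * k / c`; a rejected jump stays at the current point.
  refine ⟨c, hc, ρ₁.prod (volume.restrict (Set.Ico (0 : ℝ) 1)), inferInstance,
    fun q => if q.2.2 < B * k q.1 q.2.1 / c then q.2.1 else q.1,
    Measurable.ite hset (measurable_fst.comp measurable_snd) measurable_fst, ?_⟩
  intro f C hf hC x
  have hb0 : ∀ z, 0 ≤ B * k x z / c := fun z => by
    have := hk0 x z
    positivity
  have hb1 : ∀ z, B * k x z / c ≤ 1 := fun z => by
    rw [div_le_one hc]
    nlinarith [mul_le_mul_of_nonneg_left (hkM x z) hB0]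
  have hfz : ∀ z, |f z - f x| ≤ C + C := fun z =>
    (abs_sub _ _).trans (add_le_add (hC z) (hC x))
  have heq : ∀ v : S × ℝ, f (if v.2 < B * k x v.1 / c then v.1 else x) =
      f x + (f v.1 - f x) * (Set.Iio (B * k x v.1 / c)).indicator (fun _ => (1 : ℝ)) v.2 := by
    intro v
    by_cases h : v.2 < B * k x v.1 / c
    · rw [if_pos h, Set.indicator_of_mem (Set.mem_Iio.2 h)]
      ring
    · rw [if_neg h, Set.indicator_of_notMem (by simpa using h)]
      ring
  have hmeas : Measurable fun v : S × ℝ => (f v.1 - f x) *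
      (Set.Iio (B * k x v.1 / c)).indicator (fun _ => (1 : ℝ)) v.2 := by
    refine ((hf.comp measurable_fst).sub_const _).mul ?_
    have hs : MeasurableSet {v : S × ℝ | v.2 < B * k x v.1 / c} :=
      hset.preimage measurable_prodMk_left
    exact (measurable_const (a := (1 : ℝ))).indicator hs
  have hint : Integrable (fun v : S × ℝ => (f v.1 - f x) *
      (Set.Iio (B * k x v.1 / c)).indicator (fun _ => (1 : ℝ)) v.2)
      (ρ₁.prod (volume.restrict (Set.Ico (0 : ℝ) 1))) := by
    refine Integrable.of_bound hmeas.aestronglyMeasurable (C + C) (ae_of_all _ fun v => ?_)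
    rw [Real.norm_eq_abs, abs_mul]
    refine (mul_le_of_le_one_right (abs_nonneg _) ?_).trans (hfz v.1)
    by_cases h : v.2 ∈ Set.Iio (B * k x v.1 / c)
    · simp [Set.indicator_of_mem h]
    · simp [Set.indicator_of_notMem h]
  change ∫ v : S × ℝ, f (if v.2 < B * k x v.1 / c then v.1 else x)
    ∂ρ₁.prod (volume.restrict (Set.Ico (0 : ℝ) 1)) = _
  simp only [heq]
  rw [integral_add (integrable_const _) hint, integral_const, probReal_univ, one_smul,
    integral_prod _ hint]
  congr 1
  simp only [integral_const_mul, integral_indicator_lt_Ico (hb0 _) (hb1 _)]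
  rw [hN, integral_smul_measure, ← hB, smul_eq_mul, ← mul_assoc, ← integral_const_mul]
  refine integral_congr_ae (ae_of_all _ fun z => ?_)
  simp only
  ring

/-- The jump process of a bounded generator. -/
theorem exists_jumpProcess [TopologicalSpace S] (hk : Measurable fun q : S × S => k q.1 q.2)
    (hk0 : ∀ x y, 0 ≤ k x y) {M : ℝ} (hkM : ∀ x y, k x y ≤ M) :
    ∃ (p : ℝ≥0 → Kernel S S) (c : ℝ), 0 < c ∧ IsTransitionFunction p ∧
      (∀ f : ℕ → S → ℝ, (∀ n, Measurable (f n)) → (∀ n, ∃ C, ∀ y, |f n y| ≤ C) →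
        (∀ n x, f (n + 1) x = f n x + c⁻¹ * ∫ y, k x y * (f n y - f n x) ∂N) →
        ∀ (t : ℝ≥0) (x : S),
          HasSum (fun n => poissonWeight c n t * f n x) (∫ y, f 0 y ∂p t x)) ∧
      ∀ ν : Measure S, IsProbabilityMeasure ν →
        ∃ (W : Type u) (_ : MeasurableSpace W) (P : Measure W) (X : ℝ≥0 → W → S),
          IsMarkovProcess P p ν X ∧ ∀ w, IsCadlag fun t => X t w := by
  rcases isEmpty_or_nonempty S with hS | hS
  · refine ⟨fun _ => Kernel.id, 1, one_pos, ⟨fun _ => inferInstance, rfl, fun _ _ => ?_,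
      fun B _ => measurable_of_empty _⟩, fun _ _ _ _ _ x => isEmptyElim x, fun ν hν => ?_⟩
    · exact Kernel.ext fun x => isEmptyElim x
    · exact absurd ν.eq_zero_of_isEmpty hν.ne_zero
  · obtain ⟨c, hc, ρ, hρ, φ, hφ, h⟩ := exists_update (N := N) hk hk0 hkM
    have : Fact (0 < c) := ⟨hc⟩
    refine ⟨jumpKernel c ρ hφ, c, hc, isTransitionFunction_jumpKernel c ρ hφ, ?_, fun ν hν => ?_⟩
    · intro f hf hfC hrec t x
      obtain ⟨C, hC⟩ := hfC 0
      -- The recursion says that `f (n + 1)` is the one-step average of `f n`, which is also the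
      -- first-step recursion for expectations along the chain.
      have key : ∀ n x, f n x = ∫ ω, f 0 (chain φ n x ω) ∂noiseLaw c ρ := by
        intro n
        induction n with
        | zero => intro x; simp [chain]
        | succ n ih =>
          intro x
          obtain ⟨C', hC'⟩ := hfC n
          rw [integral_chain_succ c ρ hφ n x (hf 0) hC, hrec, ← h (f n) C' (hf n) hC' x]
          exact integral_congr_ae (ae_of_all _ fun v => ih _)
      simp only [key _ x]
      have := hasSum_integral_jumpKernel c ρ hφ t x (hf 0) hC
      exact this
    · exact ⟨S × (ℕ → ℝ≥0 × (S × ℝ)), inferInstance, ν.prod (noiseLaw c ρ),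
        fun t w => path φ w.1 w.2 t, isMarkovProcess_path c ρ hφ ν,
        fun w => isCadlag_path w.1 w.2⟩

end JumpRealization

/-! ### Assembling the solution and the process. -/

section Main

variable {K : Type u} [NontriviallyNormedField K] [IsUltrametricDist K] [ProperSpace K]
variable [MeasurableSpace K] [BorelSpace K] {μ : Measure K} {Γ : Subgroup (PGL2 K)} {F : Set K}
variable {ι : Type*} [Fintype ι] {U : ι → Set K} {A : Matrix ι ι ℝ} {α s ε : ℝ}

omit [IsUltrametricDist K] [ProperSpace K] [MeasurableSpace K] [BorelSpace K] in
theorem invKernel_nonneg (hF : IsFundDomain Γ F) (hU : IsVerticialCovering F U)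
    (hA : ∀ i j, 0 ≤ A i j) (x y : regularSet Γ) : 0 ≤ invKernel Γ U A α x y := by
  rw [invKernel_eq hF hU]
  exact baseKernel_nonneg hA _ _

/-- The Cauchy problem is solved by uniformization of the heat operator. -/
theorem exists_cauchySolution [IsFiniteMeasure (weightedMeasure μ Γ U s)]
    (hF : IsFundDomain Γ F) (hU : IsVerticialCovering F U) (hA : ∀ i, A i i = 0)
    (h₀ : invFunctions Γ) {c : ℝ} (hc : c ≠ 0) :
    ∃ h : ℝ → invFunctions Γ, IsCauchySolution μ Γ U A α s ε h₀ h ∧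
      (∃ f : ℕ → invFunctions Γ, f 0 = h₀ ∧
        (∀ n x, (f (n + 1)).1 x =
          (f n).1 x + c⁻¹ * (ε * heatOperator μ Γ U A α s (f n).1 x)) ∧
        ∀ t x, HasSum (fun n => poissonWeight c n t * (f n).1 x) ((h t).1 x)) ∧
      ∀ h' : ℝ → invFunctions Γ,
        IsCauchySolution μ Γ U A α s ε h₀ h' → Set.EqOn h' h (Set.Ici 0) := by
  have := completeSpace_invFunctions Γ
  obtain ⟨D, C, hDC, hD⟩ :=
    exists_heatOperator_linearMap (μ := μ) (α := α) (s := s) hF hU hA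
  have hεD : ∀ (f : invFunctions Γ) (x : regularSet Γ),
      ((ε • D) f).1 x = ε * heatOperator μ Γ U A α s f.1 x := fun f x => by
    rw [← hD]
    rfl
  have hbound : ∀ f : invFunctions Γ, ‖(ε • D) f‖ ≤ (|ε| * C) * ‖f‖ := fun f => by
    have h1 : ‖(ε • D) f‖ = |ε| * ‖D f‖ := norm_smul ε (D f).1
    rw [h1, mul_assoc]
    exact mul_le_mul_of_nonneg_left (hDC f) (abs_nonneg ε)
  obtain ⟨h, hdiff, hC1, hder, h0, hsum, huniq⟩ :=
    exists_solution_of_bounded (ε • D) (|ε| * C) hbound h₀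
  refine ⟨h, ⟨hdiff, hC1, fun t ht x => ?_, h0⟩,
    ⟨fun n => (fun f => f + c⁻¹ • (ε • D) f)^[n] h₀, rfl, fun n x => ?_, fun t x => ?_⟩,
    fun h' hh' => huniq h' hh'.differentiableOn (fun t ht => ?_) hh'.initial⟩
  · rw [hder t ht, hεD]
  · simp only [Function.iterate_succ_apply', ← hεD]
    rfl
  · exact (hsum c hc t).mapL
      ((BoundedContinuousFunction.evalCLM ℝ x).comp (invFunctions Γ).subtypeL)
  · refine Subtype.ext (BoundedContinuousFunction.ext fun x => ?_)
    rw [hεD]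
    exact hh'.heat_eq t ht x

theorem isFiniteMeasure_weightedMeasure (μ : Measure K) [μ.IsAddHaarMeasure]
    (hμ : μ (Metric.closedBall 0 1) = 1) {g : ℕ} (hΓ : IsSchottky Γ g)
    (hF : IsFundDomain Γ F) (hU : IsVerticialCovering F U) (hs : 0 < s)
    (hinf : OnePoint.infty ∈ regularSet Γ ∨
      (g = 1 ∧ (∀ γ ∈ Γ, γ • (OnePoint.infty : OnePoint K) = OnePoint.infty) ∧
        ∀ a : K, a ≠ 0 → ‖a‖ < 1 →
          ENNReal.ofReal (‖a‖ ^ s) < μ (Metric.closedBall 0 ‖a‖))) :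
    IsFiniteMeasure (weightedMeasure μ Γ U s) := by
  refine ⟨?_⟩
  rcases hinf with hinf | ⟨rfl, hfix, has⟩
  · exact weightedMeasure_univ_lt_top_of_infty_mem μ hF hU hs hinf
  · exact weightedMeasure_univ_lt_top_of_rank_one μ hΓ hF hU hμ hs hfix has

end Main

end MumfordHeat

theorem mainTheorem3 {K : Type u} [NontriviallyNormedField K] [IsUltrametricDist K] [ProperSpace K]
    [MeasurableSpace K] [BorelSpace K] (μ : Measure K) [μ.IsAddHaarMeasure]
    (hμ : μ (Metric.closedBall 0 1) = 1)
    (g : ℕ) (Γ : Subgroup (MumfordHeat.PGL2 K)) (hΓ : MumfordHeat.IsSchottky Γ g)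
    (F : Set K) (hF : MumfordHeat.IsFundDomain Γ F)
    {ι : Type*} [Fintype ι] (U : ι → Set K) (hU : MumfordHeat.IsVerticialCovering F U)
    (A : Matrix ι ι ℝ) (hA_symm : A.IsSymm) (hA_nonneg : ∀ i j, 0 ≤ A i j)
    (hA_diag : ∀ i, A i i = 0)
    (α s ε : ℝ) (hs : 0 < s) (hε : 0 < ε)
    (hinf : OnePoint.infty ∈ MumfordHeat.regularSet Γ ∨
      (g = 1 ∧ (∀ γ ∈ Γ, γ • (OnePoint.infty : OnePoint K) = OnePoint.infty) ∧
        ∀ a : K, a ≠ 0 → ‖a‖ < 1 →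
          ENNReal.ofReal (‖a‖ ^ s) < μ (Metric.closedBall 0 ‖a‖))) :
    (∀ f : MumfordHeat.invFunctions Γ, ∀ x : MumfordHeat.regularSet Γ,
      Integrable (fun y : MumfordHeat.regularSet Γ =>
        MumfordHeat.invKernel Γ U A α x y * (f.1 y - f.1 x))
        (MumfordHeat.weightedMeasure μ Γ U s)) ∧
    ∃ p : ℝ≥0 → Kernel (MumfordHeat.regularSet Γ) (MumfordHeat.regularSet Γ),
      MumfordHeat.IsTransitionFunction p ∧
      (∀ h₀ : MumfordHeat.invFunctions Γ, ∃ h : ℝ → MumfordHeat.invFunctions Γ,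
        MumfordHeat.IsCauchySolution μ Γ U A α s ε h₀ h ∧
        (∀ (t : ℝ≥0) (x : MumfordHeat.regularSet Γ), (h t).1 x = ∫ y, h₀.1 y ∂(p t x)) ∧
        ∀ h' : ℝ → MumfordHeat.invFunctions Γ,
          MumfordHeat.IsCauchySolution μ Γ U A α s ε h₀ h' → Set.EqOn h' h (Set.Ici 0)) ∧
      ∀ ν : Measure (MumfordHeat.regularSet Γ), IsProbabilityMeasure ν →
        ∃ (W : Type u) (_ : MeasurableSpace W) (P : Measure W)
          (X : ℝ≥0 → W → MumfordHeat.regularSet Γ),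
          MumfordHeat.IsMarkovProcess P p ν X ∧
          ∀ w, MumfordHeat.IsCadlag (fun t => X t w) := by
  have := MumfordHeat.isFiniteMeasure_weightedMeasure μ hμ hΓ hF hU hs hinf
  refine ⟨fun f x => MumfordHeat.integrable_invKernel_mul hF hU hA_diag
    (f.1.continuous.measurable.sub_const _)
    (fun y => MumfordHeat.abs_sub_le_two_mul_norm f.1 x y) x, ?_⟩
  obtain ⟨M, -, hM⟩ := MumfordHeat.exists_bound_invKernel (α := α) hF hU hA_diag
  -- The factor `ε` is absorbed into the jump kernel, so `p` belongs to `ε D`; the rate `c` found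
  -- here is reused to expand the solution.
  obtain ⟨p, c, hc, hp, hrep, hproc⟩ := MumfordHeat.exists_jumpProcess
    (N := MumfordHeat.weightedMeasure μ Γ U s)
    (k := fun x y : MumfordHeat.regularSet Γ => ε * MumfordHeat.invKernel Γ U A α x y) (M := ε * M)
    ((MumfordHeat.measurable_invKernel hF hU).const_mul ε)
    (fun x y => mul_nonneg hε.le (MumfordHeat.invKernel_nonneg hF hU hA_nonneg x y))
    (fun x y => mul_le_mul_of_nonneg_left ((le_abs_self _).trans (hM x y)) hε.le)
  refine ⟨p, hp, fun h₀ => ?_, hproc⟩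
  obtain ⟨h, hsol, ⟨f, hf0, hrec, hsum⟩, huniq⟩ := MumfordHeat.exists_cauchySolution
    (μ := μ) (α := α) (s := s) (ε := ε) hF hU hA_diag h₀ hc.ne'
  refine ⟨h, hsol, fun t x => ?_, huniq⟩
  rw [← hf0]
  -- The solution and the expectation are sums of the same Poisson series.
  refine (hsum t x).unique (hrep (fun n => (f n).1) (fun n => (f n).1.continuous.measurable)
    (fun n => ⟨‖(f n).1‖, (f n).1.norm_coe_le_norm⟩) (fun n x => ?_) t x)
  rw [hrec, MumfordHeat.heatOperator, ← integral_const_mul]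
  simp only [mul_assoc]
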